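/- Let $\mathbb T$ be the unit circle with normalized Lebesgue measure $m$, and let $H^2\subset L^2(\mathbb T)=L^2(m)$ be the Hardy space, i.e. the functions whose Fourier coefficients of negative index vanish. Let $\Lambda=(\lambda_j)_{j\ge 0}$ be an arbitrary sequence in the open unit disk $\mathbb D$. For $N\ge 1$ let $$B_N(z)=\prod_{j=0}^{N-1}\frac{\overline{\lambda_j}}{|\lambda_j|}\,\frac{z-\lambda_j}{1-\overline{\lambda_j}\,z}\qquad\bigl(\text{with } \overline{\lambda_j}/|\lambda_j|:=1 \text{ if } \lambda_j=0\bigr)$$ be the Blaschke product with zeros $\lambda_0,\dots,\lambda_{N-1}$, let $K_{B_N}=H^2\ominus B_NH^2$ be the associated ($N$-dimensional) model space, and for $\varphi\in L^\infty(\mathbb T)$ let $T_{B_N}(\varphi)$ be the truncated Toeplitz operator on $K_{B_N}$, $T_{B_N}(\varphi)u=P_{K_{B_N}}(\varphi u)$, where $P_{K_{B_N}}$ is the orthogonal projection of $L^2(\mathbb T)$ onto $K_{B_N}$. Let $$d\nu_N(\zeta)=\frac1N\sum_{j=0}^{N-1}\frac{1-|\lambda_j|^2}{|\zeta-\lambda_j|^2}\,dm(\zeta)$$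 be the mean of the harmonic measures on $\mathbb T$ at $\lambda_0,\dots,\lambda_{N-1}$, and let $\mathcal X_\Lambda$ be the closure of $C(\mathbb T)$ in the norm $\|f\|_\Lambda=\sup_{N\ge1}\|f\|_{L^2(\nu_N)}$. Let $\varphi\in L^\infty(\mathbb T)\cap\mathcal X_\Lambda$ and let $f$ be analytic on a neighbourhood of the closed convex hull of the essential range of $\varphi$. Then $$\lim_{N\to\infty}\left|\frac1N\operatorname{Tr} f\bigl(T_{B_N}(\varphi)\bigr)-\int_{\mathbb T} f(\varphi(\zeta))\,d\nu_N(\zeta)\right|=0,$$ where $f(T_{B_N}(\varphi))$ is defined by the holomorphic (Riesz--Dunford) functional calculus. Moreover, if $\varphi$ is real-valued, the same limit relation holds for every complex-valued $f$ that is continuous on $[\operatorname{ess\,inf}\varphi,\operatorname{ess\,sup}\varphi]$, where now $f(T_{B_N}(\varphi))$ is defined by the continuous functional calculus of the self-adjoint operator $T_{B_N}(\varphi)$. -/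

import Mathlib

open MeasureTheory Filter Topology
open scoped ENNReal ComplexConjugate

noncomputable section

namespace SzegoTTO

/-- The unit circle `𝕋`, parametrised by `t ∈ ℝ/ℤ` through `ζ = exp(2πit)`. -/
abbrev 𝕋 : Type := UnitAddCircle

/-- Normalised Lebesgue measure on `𝕋`. -/
abbrev m : Measure 𝕋 := AddCircle.haarAddCircle

/-- The point `ζ = exp(2πit)` of the unit circle in `ℂ` with parameter `t`. -/
def pt (t : 𝕋) : ℂ := (AddCircle.toCircle t : ℂ)

/-- The Hilbert space `L²(𝕋)`. -/
abbrev L2 : Type := Lp ℂ 2 m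

/-- The space `L^∞(𝕋)`. -/
abbrev Linf : Type := Lp ℂ ∞ m

/-- The Hardy space `H²` as a subspace of `L²(𝕋)`: the functions all of whose Fourier
coefficients with negative index vanish. -/
def hardy : Submodule ℂ L2 where
  carrier := {f | ∀ n : ℤ, n < 0 → fourierCoeff (f : 𝕋 → ℂ) n = 0}
  zero_mem' := by
    intro n _
    rw [← fourierBasis_repr]
    simp
  add_mem' := by
    intro f g hf hg n hn
    have h1 := hf n hn
    have h2 := hg n hn
    rw [← fourierBasis_repr] at h1 h2 ⊢
    simp [h1, h2]
  smul_mem' := by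
    intro c f hf n hn
    have h1 := hf n hn
    rw [← fourierBasis_repr] at h1 ⊢
    simp [h1]

lemma isClosed_hardy : IsClosed (hardy : Set L2) := by
  have h : (hardy : Set L2) =
      ⋂ n : ℤ, ⋂ _ : n < 0, {f : L2 | inner ℂ (fourierBasis (T := 1) n) f = 0} := by
    ext f
    simp only [Set.mem_iInter, Set.mem_ofPred_eq]
    refine forall_congr' fun n => forall_congr' fun _ => ?_
    rw [← HilbertBasis.repr_apply_apply, fourierBasis_repr]
  rw [h]
  refine isClosed_iInter fun n => isClosed_iInter fun _ => ?_
  exact isClosed_eq (by fun_prop) continuous_const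

/-- The subspace `B H² = {B g : g ∈ H²}` of `L²(𝕋)`, for a function `B` on the circle. -/
def mulHardy (B : 𝕋 → ℂ) : Submodule ℂ L2 where
  carrier := {h | ∃ g ∈ hardy, (h : 𝕋 → ℂ) =ᵐ[m] fun t => B t * (g : 𝕋 → ℂ) t}
  zero_mem' := by
    refine ⟨0, hardy.zero_mem, ?_⟩
    filter_upwards [Lp.coeFn_zero ℂ 2 m] with t ht
    rw [ht]
    simp
  add_mem' := by
    rintro h₁ h₂ ⟨g₁, hg₁, e₁⟩ ⟨g₂, hg₂, e₂⟩
    refine ⟨g₁ + g₂, hardy.add_mem hg₁ hg₂, ?_⟩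
    filter_upwards [e₁, e₂, Lp.coeFn_add h₁ h₂, Lp.coeFn_add g₁ g₂] with t a b c d
    rw [c, d, Pi.add_apply, Pi.add_apply, a, b, mul_add]
  smul_mem' := by
    rintro c h ⟨g, hg, e⟩
    refine ⟨c • g, hardy.smul_mem c hg, ?_⟩
    filter_upwards [e, Lp.coeFn_smul c h, Lp.coeFn_smul c g] with t a b d
    simp [a, b, d, mul_left_comm]

/-- The model space `K_B = H² ⊖ B H²`. -/
def modelSpace (B : 𝕋 → ℂ) : Submodule ℂ L2 := hardy ⊓ (mulHardy B)ᗮ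

instance (B : 𝕋 → ℂ) : CompleteSpace (modelSpace B) :=
  (isClosed_hardy.inter (mulHardy B).isClosed_orthogonal).completeSpace_coe

/-- Multiplication by `φ ∈ L^∞(𝕋)` on `L²(𝕋)`. -/
def mulOp (φ : Linf) : L2 →L[ℂ] L2 := (ContinuousLinearMap.mul ℂ ℂ).holderL m ∞ 2 2 φ

/-- The truncated Toeplitz operator `T_B(φ)`: the compression to `K_B` of multiplication
by `φ`, that is `u ↦ P_{K_B}(φ u)`. -/
def truncToeplitz (B : 𝕋 → ℂ) (φ : Linf) : modelSpace B →L[ℂ] modelSpace B :=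
  (modelSpace B).orthogonalProjectionOnto ∘L mulOp φ ∘L (modelSpace B).subtypeL

/-- The Blaschke product `B_N` with zeros `Λ 0, …, Λ (N - 1)`. -/
def blaschke (Λ : ℕ → ℂ) (N : ℕ) (z : ℂ) : ℂ :=
  ∏ j ∈ Finset.range N,
    (if Λ j = 0 then 1 else conj (Λ j) / (‖Λ j‖ : ℂ)) * ((z - Λ j) / (1 - conj (Λ j) * z))

/-- The operator `T_{B_N}(φ)` on `K_{B_N}`. -/
abbrev toeplitzN (Λ : ℕ → ℂ) (N : ℕ) (φ : Linf) :
    modelSpace (fun t => blaschke Λ N (pt t)) →L[ℂ] modelSpace (fun t => blaschke Λ N (pt t)) :=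
  truncToeplitz (fun t => blaschke Λ N (pt t)) φ

/-- The mean `ν_N` of the harmonic measures on `𝕋` at `Λ 0, …, Λ (N - 1)`. -/
def nu (Λ : ℕ → ℂ) (N : ℕ) : Measure 𝕋 :=
  m.withDensity fun t => ENNReal.ofReal
    ((1 / (N : ℝ)) * ∑ j ∈ Finset.range N, (1 - ‖Λ j‖ ^ 2) / ‖pt t - Λ j‖ ^ 2)

/-- The norm `‖f‖_Λ = sup_{N ≥ 1} ‖f‖_{L²(ν_N)}` (possibly infinite). -/
def normΛ (Λ : ℕ → ℂ) (f : 𝕋 → ℂ) : ℝ≥0∞ := ⨆ N : ℕ, ⨆ _ : 1 ≤ N, eLpNorm f 2 (nu Λ N)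

/-- The space `𝒳_Λ`: the closure of `C(𝕋)` in the norm `‖·‖_Λ`. -/
def spaceX (Λ : ℕ → ℂ) : Set (𝕋 → ℂ) :=
  {f | AEStronglyMeasurable f m ∧
    ∀ ε : ℝ≥0∞, 0 < ε → ∃ g : C(𝕋, ℂ), normΛ Λ (fun t => f t - g t) < ε}

/-- The essential range of a function on `𝕋`. -/
def essRange (φ : 𝕋 → ℂ) : Set ℂ := {w | ∀ ε : ℝ, 0 < ε → 0 < m {t | ‖φ t - w‖ < ε}}

/-- The Riesz–Dunford functional calculus `f(T) = (2πi)⁻¹ ∫_Γ f(z) (z - T)⁻¹ dz` for an element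
`T` with finite spectrum. The contour `Γ` consists of the circles of radius `r` around the points
of the spectrum; for `f` holomorphic near the spectrum the integral does not depend on `r` once
`r > 0` is small, and the limit as `r → 0` is this common value. -/
def holFC {A : Type*} [NormedRing A] [NormedAlgebra ℂ A] (f : ℂ → ℂ) (T : A) : A :=
  letI : Nonempty A := ⟨0⟩
  limUnder (𝓝[>] (0 : ℝ)) fun r : ℝ =>
    (2 * (Real.pi : ℂ) * Complex.I)⁻¹ •
      ∑ᶠ μ ∈ spectrum ℂ T, ∮ z in C(μ, r), f z • resolvent T z

/-- The operator `f(T)` given by the continuous functional calculus, for a self-adjoint operator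
`T` on a Hilbert space and a complex-valued function `f` on the real line. -/
def contFC {E : Type*} [NormedAddCommGroup E] [InnerProductSpace ℂ E] [CompleteSpace E]
    (f : ℝ → ℂ) (T : E →L[ℂ] E) : E →L[ℂ] E :=
  cfc (p := IsStarNormal) (fun z : ℂ => f z.re) T

/-- The trace of a bounded operator on a (finite-dimensional) space. -/
def tr {E : Type*} [NormedAddCommGroup E] [NormedSpace ℂ E] (S : E →L[ℂ] E) : ℂ :=
  LinearMap.trace ℂ E (S : E →ₗ[ℂ] E)

end SzegoTTO

end

/-!
Compress operators of `L²(𝕋)` to the spaces `K_{B_N}` and call `A` almost invariant if the part of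
`A|K_{B_N}` that leaves `K_{B_N}` has Hilbert–Schmidt norm `o(√N)`. The almost invariant operators
form a closed algebra, and for such an `A` the map `p ↦ p(A)` commutes with compression up to
operators whose trace is `o(N)`.

For multiplication by `z` and by `z⁻¹` the part leaving the model space has rank one and norm at
most one, so multiplication by a continuous function is almost invariant by Stone–Weierstrass. In
the Takenaka–Malmquist basis `e₀, …, e_{N-1}` of `K_{B_N}` one has `∑ |e_k|² dm = N dν_N`.
Therefore the Hilbert–Schmidt norm of multiplication by `ψ` on `K_{B_N}` is `√N ‖ψ‖_{L²(ν_N)}`,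
which makes multiplication by `φ ∈ 𝒳_Λ` almost invariant, and the trace of the compression of
multiplication by `p(φ)` is `N ∫ p(φ) dν_N`: the theorem holds for polynomials.

The spectrum of `T_{B_N}(φ)` lies in the closed convex hull of the essential range of `φ`, so a
uniform approximation of `f` by polynomials there changes both sides by little. For holomorphic
`f` the approximation is Runge's theorem on a compact convex set, and `Tr f(T)` is the sum of `f`
over the eigenvalues with algebraic multiplicity.
-/

noncomputable section

namespace SzegoTTO

section HilbertSchmidt

variable {𝕜 ι κ E F G : Type*} [RCLike 𝕜] [Fintype ι] [Fintype κ]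
  [NormedAddCommGroup E] [InnerProductSpace 𝕜 E] [NormedAddCommGroup F] [InnerProductSpace 𝕜 F]
  [NormedAddCommGroup G] [InnerProductSpace 𝕜 G]

/-- The Hilbert–Schmidt norm of an operator, computed in the orthonormal basis `b`. -/
def hsNorm (b : OrthonormalBasis ι 𝕜 E) (A : E →L[𝕜] F) : ℝ :=
  ‖(WithLp.toLp 2 fun i => A (b i) : PiLp 2 fun _ : ι => F)‖

lemma hsNorm_nonneg (b : OrthonormalBasis ι 𝕜 E) (A : E →L[𝕜] F) : 0 ≤ hsNorm b A :=
  norm_nonneg _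

lemma hsNorm_sq (b : OrthonormalBasis ι 𝕜 E) (A : E →L[𝕜] F) :
    hsNorm b A ^ 2 = ∑ i, ‖A (b i)‖ ^ 2 := by
  rw [hsNorm, PiLp.norm_sq_eq_of_L2]

lemma hsNorm_add_le (b : OrthonormalBasis ι 𝕜 E) (A B : E →L[𝕜] F) :
    hsNorm b (A + B) ≤ hsNorm b A + hsNorm b B :=
  norm_add_le (WithLp.toLp 2 fun i => A (b i) : PiLp 2 fun _ : ι => F)
    (WithLp.toLp 2 fun i => B (b i))

@[simp]
lemma hsNorm_zero (b : OrthonormalBasis ι 𝕜 E) : hsNorm b (0 : E →L[𝕜] F) = 0 :=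
  norm_zero (E := PiLp 2 fun _ : ι => F)

lemma hsNorm_comp_le (b : OrthonormalBasis ι 𝕜 E) (C : F →L[𝕜] G) (A : E →L[𝕜] F) :
    hsNorm b (C ∘L A) ≤ ‖C‖ * hsNorm b A := by
  refine le_of_sq_le_sq ?_ (by positivity [hsNorm_nonneg b A])
  rw [mul_pow, hsNorm_sq, hsNorm_sq, Finset.mul_sum]
  refine Finset.sum_le_sum fun i _ => ?_
  rw [← mul_pow]
  exact pow_le_pow_left₀ (norm_nonneg _) (C.le_opNorm _) 2

lemma sum_sq_norm_apply_eq_sq_norm (b : OrthonormalBasis ι 𝕜 E) (l : E →L[𝕜] 𝕜) :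
    ∑ i, ‖l (b i)‖ ^ 2 = ‖l‖ ^ 2 := by
  have : FiniteDimensional 𝕜 E := b.toBasis.finiteDimensional_of_finite
  have : CompleteSpace E := FiniteDimensional.complete 𝕜 E
  obtain ⟨y, rfl⟩ := (InnerProductSpace.toDual 𝕜 E).surjective l
  simpa using b.sum_sq_norm_inner_left y

lemma hsNorm_sq_eq_sum_sq_norm_innerSL_comp (b : OrthonormalBasis ι 𝕜 E)
    (c : OrthonormalBasis κ 𝕜 F) (A : E →L[𝕜] F) :
    hsNorm b A ^ 2 = ∑ j, ‖innerSL 𝕜 (c j) ∘L A‖ ^ 2 := by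
  calc hsNorm b A ^ 2 = ∑ i, ∑ j, ‖inner 𝕜 (c j) (A (b i))‖ ^ 2 := by
        simp_rw [hsNorm_sq, c.sum_sq_norm_inner_right]
    _ = ∑ j, ∑ i, ‖(innerSL 𝕜 (c j) ∘L A) (b i)‖ ^ 2 := Finset.sum_comm
    _ = ∑ j, ‖innerSL 𝕜 (c j) ∘L A‖ ^ 2 := by simp_rw [sum_sq_norm_apply_eq_sq_norm]

lemma hsNorm_codRestrict (b : OrthonormalBasis ι 𝕜 E) (A : E →L[𝕜] F) (R : Submodule 𝕜 F)
    (hR : ∀ x, A x ∈ R) : hsNorm b (A.codRestrict R hR) = hsNorm b A := by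
  rw [hsNorm, hsNorm, PiLp.norm_eq_of_L2, PiLp.norm_eq_of_L2]
  rfl

lemma hsNorm_comp_le_mul (b : OrthonormalBasis ι 𝕜 E) (A : E →L[𝕜] F) (C : E →L[𝕜] E) :
    hsNorm b (A ∘L C) ≤ hsNorm b A * ‖C‖ := by
  have : FiniteDimensional 𝕜 E := b.toBasis.finiteDimensional_of_finite
  let R : Submodule 𝕜 F := (A : E →ₗ[𝕜] F).range
  have hR (x : E) : A x ∈ R := ⟨x, rfl⟩
  let c := stdOrthonormalBasis 𝕜 R
  refine le_of_sq_le_sq ?_ (by positivity [hsNorm_nonneg b A])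
  rw [mul_pow, ← hsNorm_codRestrict b A R hR, ← hsNorm_codRestrict b (A ∘L C) R fun _ => hR _,
    hsNorm_sq_eq_sum_sq_norm_innerSL_comp b c, hsNorm_sq_eq_sum_sq_norm_innerSL_comp b c,
    Finset.sum_mul]
  refine Finset.sum_le_sum fun j _ => ?_
  rw [← mul_pow]
  exact pow_le_pow_left₀ (norm_nonneg _)
    (ContinuousLinearMap.opNorm_comp_le (innerSL 𝕜 (c j) ∘L A.codRestrict R hR) C) 2

lemma norm_trace_le_hsNorm (b : OrthonormalBasis ι 𝕜 E) (A : E →L[𝕜] E) :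
    ‖LinearMap.trace 𝕜 E (A : E →ₗ[𝕜] E)‖ ≤ √(Fintype.card ι) * hsNorm b A := by
  have hsum : ‖LinearMap.trace 𝕜 E (A : E →ₗ[𝕜] E)‖ ≤ ∑ i, ‖A (b i)‖ := by
    rw [LinearMap.trace_eq_sum_inner _ b]
    refine (norm_sum_le _ _).trans (Finset.sum_le_sum fun i _ => ?_)
    simpa using norm_inner_le_norm (𝕜 := 𝕜) (b i) (A (b i))
  refine hsum.trans (le_of_sq_le_sq ?_ (by positivity [hsNorm_nonneg b A]))
  rw [mul_pow, Real.sq_sqrt (by positivity), hsNorm_sq]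
  exact sq_sum_le_card_mul_sum_sq

lemma hsNorm_le_sqrt_mul_opNorm (b : OrthonormalBasis ι 𝕜 E) (A : E →L[𝕜] F) :
    hsNorm b A ≤ √(Fintype.card ι) * ‖A‖ := by
  refine le_of_sq_le_sq ?_ (by positivity)
  calc hsNorm b A ^ 2 ≤ ∑ _i : ι, ‖A‖ ^ 2 := by
        rw [hsNorm_sq]
        gcongr with i
        simpa using A.le_opNorm (b i)
    _ = (√(Fintype.card ι) * ‖A‖) ^ 2 := by
        rw [mul_pow, Real.sq_sqrt (by positivity)]
        simp

lemma norm_trace_le_opNorm (b : OrthonormalBasis ι 𝕜 E) (A : E →L[𝕜] E) :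
    ‖LinearMap.trace 𝕜 E (A : E →ₗ[𝕜] E)‖ ≤ Fintype.card ι * ‖A‖ := by
  rw [LinearMap.trace_eq_sum_inner _ b]
  refine (norm_sum_le _ _).trans ?_
  rw [← nsmul_eq_mul, Fintype.card, ← Finset.sum_const]
  refine Finset.sum_le_sum fun i _ => (norm_inner_le_norm (𝕜 := 𝕜) _ _).trans ?_
  simpa using A.le_opNorm (b i)

end HilbertSchmidt

section Compression

variable {𝕜 H : Type*} [RCLike 𝕜] [NormedAddCommGroup H] [InnerProductSpace 𝕜 H]
  (K : Submodule 𝕜 H) [K.HasOrthogonalProjection]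

/-- The compression `u ↦ P_K (A u)` of an operator to a subspace. -/
def compress : (H →L[𝕜] H) →ₗ[𝕜] (K →L[𝕜] K) where
  toFun A := K.orthogonalProjectionOnto ∘L A ∘L K.subtypeL
  map_add' _ _ := by ext; simp
  map_smul' _ _ := by ext; simp

/-- The part of an operator that maps a subspace into its orthogonal complement; it vanishes if and
only if the subspace is invariant. -/
def offDiag : (H →L[𝕜] H) →ₗ[𝕜] (K →L[𝕜] H) where
  toFun A := Kᗮ.starProjection ∘L A ∘L K.subtypeL
  map_add' _ _ := by ext; simp
  map_smul' _ _ := by ext; simp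

lemma compress_one : compress K 1 = 1 := by
  ext; simp [compress]

lemma offDiag_apply (A : H →L[𝕜] H) (x : K) :
    offDiag K A x = A x - K.starProjection (A x) := by
  simp [offDiag, Submodule.starProjection_orthogonal_val]

lemma offDiag_one : offDiag K 1 = 0 := by
  ext x; simp [offDiag_apply]

lemma inner_compress_left (A : H →L[𝕜] H) (x y : K) :
    inner 𝕜 (compress K A x) y = inner 𝕜 (A x) (y : H) :=
  Submodule.inner_orthogonalProjectionOnto_eq_of_mem_right y (A x)

lemma inner_compress_right (A : H →L[𝕜] H) (x y : K) :
    inner 𝕜 x (compress K A y) = inner 𝕜 (x : H) (A y) :=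
  Submodule.inner_orthogonalProjectionOnto_eq_of_mem_left x (A y)

lemma isSelfAdjoint_compress [CompleteSpace H] [CompleteSpace K] {A : H →L[𝕜] H}
    (hA : IsSelfAdjoint A) : IsSelfAdjoint (compress K A) := by
  refine ContinuousLinearMap.isSelfAdjoint_iff_isSymmetric.2 fun x y => ?_
  exact (inner_compress_left K A x y).trans <|
    (hA.isSymmetric (x : H) y).trans (inner_compress_right K A x y).symm

lemma norm_compress_le (A : H →L[𝕜] H) : ‖compress K A‖ ≤ ‖A‖ :=
  ContinuousLinearMap.opNorm_le_bound _ (norm_nonneg _) fun _ =>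
    (K.norm_orthogonalProjectionOnto_apply_le _).trans (A.le_opNorm _)

lemma compress_mul (A B : H →L[𝕜] H) :
    compress K (A * B) = compress K A * compress K B +
      (K.orthogonalProjectionOnto ∘L A) ∘L offDiag K B := by
  ext x
  simp [compress, offDiag_apply]

lemma offDiag_mul (A B : H →L[𝕜] H) :
    offDiag K (A * B) = (Kᗮ.starProjection ∘L A) ∘L offDiag K B +
      offDiag K A ∘L compress K B := by
  ext x
  have hB : A (offDiag K B x) = A (B x) - A (K.starProjection (B x)) := by
    rw [offDiag_apply, map_sub]
  simp only [ContinuousLinearMap.coe_comp, add_apply, Function.comp_apply, hB, map_sub]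
  simp [offDiag, compress]

variable {K}

lemma offDiag_eq_of_sub_mem {A : H →L[𝕜] H} {x : K} {w : H} (hAx : A x - w ∈ K) (hw : w ∈ Kᗮ) :
    offDiag K A x = w := by
  rw [offDiag_apply, Submodule.eq_starProjection_of_mem_orthogonal' hAx hw
    (sub_add_cancel _ _).symm, sub_sub_cancel]

variable {ι : Type*} [Fintype ι] (b : OrthonormalBasis ι 𝕜 K)

lemma hsNorm_compress_mul_sub_mul_le (A B : H →L[𝕜] H) (S : K →L[𝕜] K) :
    hsNorm b (compress K (A * B) - compress K A * S) ≤
      ‖A‖ * hsNorm b (offDiag K B) + ‖A‖ * hsNorm b (compress K B - S) := by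
  have hsplit : compress K (A * B) - compress K A * S =
      (K.orthogonalProjectionOnto ∘L A) ∘L offDiag K B + compress K A ∘L (compress K B - S) := by
    rw [compress_mul, ← ContinuousLinearMap.mul_def, mul_sub]
    abel
  rw [hsplit]
  refine (hsNorm_add_le b _ _).trans (add_le_add ?_ ?_) <;>
    refine (hsNorm_comp_le b _ _).trans (mul_le_mul_of_nonneg_right ?_ (hsNorm_nonneg _ _))
  · exact (ContinuousLinearMap.opNorm_comp_le _ _).trans
      (mul_le_of_le_one_left (norm_nonneg _) K.orthogonalProjectionOnto_norm_le)
  · exact norm_compress_le K A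

lemma hsNorm_offDiag_le (A : H →L[𝕜] H) :
    hsNorm b (offDiag K A) ≤ hsNorm b (A ∘L K.subtypeL) :=
  (hsNorm_comp_le b _ _).trans
    (mul_le_of_le_one_left (hsNorm_nonneg _ _) Kᗮ.starProjection_norm_le)

lemma hsNorm_offDiag_mul_le (A B : H →L[𝕜] H) :
    hsNorm b (offDiag K (A * B)) ≤
      ‖A‖ * hsNorm b (offDiag K B) + ‖B‖ * hsNorm b (offDiag K A) := by
  rw [offDiag_mul]
  refine (hsNorm_add_le b _ _).trans (add_le_add ?_ ?_)
  · refine (hsNorm_comp_le b _ _).trans (mul_le_mul_of_nonneg_right ?_ (hsNorm_nonneg _ _))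
    exact (ContinuousLinearMap.opNorm_comp_le _ _).trans
      (mul_le_of_le_one_left (norm_nonneg _) Kᗮ.starProjection_norm_le)
  · refine (hsNorm_comp_le_mul b _ _).trans ?_
    rw [mul_comm]
    exact mul_le_mul_of_nonneg_right (norm_compress_le K B) (hsNorm_nonneg _ _)

lemma hsNorm_offDiag_le_of_eq_inner_smul {A : H →L[𝕜] H} {v w : H}
    (hA : ∀ x : K, offDiag K A x = inner 𝕜 v (x : H) • w) :
    hsNorm b (offDiag K A) ≤ ‖v‖ * ‖w‖ := by
  have hb : Orthonormal 𝕜 fun i => (b i : H) := b.orthonormal.comp_linearIsometry K.subtypeₗᵢ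
  refine le_of_sq_le_sq ?_ (by positivity)
  simp only [hsNorm_sq, hA, norm_smul, mul_pow, ← Finset.sum_mul, norm_inner_symm v]
  exact mul_le_mul_of_nonneg_right (hb.sum_inner_products_le v) (by positivity)

end Compression

section AlmostInvariant

open Asymptotics

variable {𝕜 H α : Type*} [RCLike 𝕜] [NormedAddCommGroup H] [InnerProductSpace 𝕜 H]
  {K : α → Submodule 𝕜 H} [∀ a, (K a).HasOrthogonalProjection]
  {ι : α → Type*} [∀ a, Fintype (ι a)]

/-- The operators that leave the finite-dimensional subspaces `K a` invariant up to an error which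
is `o(√(dim K a))` in the Hilbert–Schmidt norm. The dimension is the cardinality of the index type
of the basis `b a` of `K a`. -/
def almostInvariant (l : Filter α) (b : ∀ a, OrthonormalBasis (ι a) 𝕜 (K a)) :
    Subalgebra 𝕜 (H →L[𝕜] H) where
  carrier := {A | (fun a => hsNorm (b a) (offDiag (K a) A)) =o[l] fun a => √(Fintype.card (ι a))}
  mul_mem' {A B} hA hB := by
    refine (IsBigO.of_norm_le fun a => ?_).trans_isLittleO
      ((hB.const_mul_left ‖A‖).add (hA.const_mul_left ‖B‖))
    rw [Real.norm_of_nonneg (hsNorm_nonneg _ _)]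
    exact hsNorm_offDiag_mul_le (b a) A B
  add_mem' {A B} hA hB := by
    refine (IsBigO.of_norm_le fun a => ?_).trans_isLittleO (hA.add hB)
    rw [Real.norm_of_nonneg (hsNorm_nonneg _ _), map_add]
    exact hsNorm_add_le (b a) _ _
  algebraMap_mem' c := by
    simp [Algebra.algebraMap_eq_smul_one, offDiag_one]

variable {l : Filter α} {b : ∀ a, OrthonormalBasis (ι a) 𝕜 (K a)} {A : H →L[𝕜] H}

lemma mem_almostInvariant : A ∈ almostInvariant l b ↔
    (fun a => hsNorm (b a) (offDiag (K a) A)) =o[l] fun a => √(Fintype.card (ι a)) :=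
  Iff.rfl

lemma mem_almostInvariant_of_hsNorm_le (hcard : Tendsto (fun a => Fintype.card (ι a)) l atTop)
    (C : ℝ) (hC : ∀ a, hsNorm (b a) (offDiag (K a) A) ≤ C) : A ∈ almostInvariant l b := by
  refine (IsBigO.of_norm_le fun a => ?_).trans_isLittleO
    ((isLittleO_const_left (c := C)).2 (.inr ?_))
  · exact (Real.norm_of_nonneg (hsNorm_nonneg _ _)).trans_le (hC a)
  · exact tendsto_norm_atTop_atTop.comp
      (Real.tendsto_sqrt_atTop.comp (tendsto_natCast_atTop_atTop.comp hcard))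

lemma mem_almostInvariant_of_approx
    (hA : ∀ ε : ℝ, 0 < ε → ∃ B ∈ almostInvariant l b, ∀ᶠ a in l,
      hsNorm (b a) ((A - B) ∘L (K a).subtypeL) ≤ ε * √(Fintype.card (ι a))) :
    A ∈ almostInvariant l b := by
  refine isLittleO_iff.2 fun ε hε => ?_
  obtain ⟨B, hB, hAB⟩ := hA (ε / 2) (half_pos hε)
  filter_upwards [hAB, isLittleO_iff.1 (mem_almostInvariant.1 hB) (half_pos hε)] with a hABa hBa
  rw [Real.norm_of_nonneg (hsNorm_nonneg _ _), Real.norm_of_nonneg (Real.sqrt_nonneg _)] at hBa ⊢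
  calc hsNorm (b a) (offDiag (K a) A)
      = hsNorm (b a) (offDiag (K a) (A - B) + offDiag (K a) B) := by rw [← map_add, sub_add_cancel]
    _ ≤ hsNorm (b a) (offDiag (K a) (A - B)) + hsNorm (b a) (offDiag (K a) B) :=
        hsNorm_add_le _ _ _
    _ ≤ ε / 2 * √(Fintype.card (ι a)) + ε / 2 * √(Fintype.card (ι a)) :=
        add_le_add ((hsNorm_offDiag_le _ _).trans hABa) hBa
    _ = ε * √(Fintype.card (ι a)) := by ring

lemma isClosed_almostInvariant : IsClosed (almostInvariant l b : Set (H →L[𝕜] H)) := by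
  refine isClosed_of_closure_subset fun A hA => mem_almostInvariant_of_approx fun ε hε => ?_
  obtain ⟨B, hB, hAB⟩ := Metric.mem_closure_iff.1 hA ε hε
  refine ⟨B, hB, .of_forall fun a => (hsNorm_le_sqrt_mul_opNorm _ _).trans ?_⟩
  rw [mul_comm]
  gcongr
  calc ‖(A - B) ∘L (K a).subtypeL‖ ≤ ‖A - B‖ * ‖(K a).subtypeL‖ :=
        ContinuousLinearMap.opNorm_comp_le _ _
    _ ≤ ‖A - B‖ := mul_le_of_le_one_right (norm_nonneg _) (Submodule.norm_subtypeL_le _)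
    _ ≤ ε := by rw [← dist_eq_norm]; exact hAB.le

lemma isLittleO_hsNorm_compress_aeval_sub (hA : A ∈ almostInvariant l b) (p : Polynomial 𝕜) :
    (fun a => hsNorm (b a) (compress (K a) (Polynomial.aeval A p) -
      Polynomial.aeval (compress (K a) A) p)) =o[l] fun a => √(Fintype.card (ι a)) := by
  induction p using Polynomial.induction_on with
  | C c => simp [Algebra.algebraMap_eq_smul_one, compress_one]
  | add p q hp hq =>
    refine (IsBigO.of_norm_le fun a => ?_).trans_isLittleO (hp.add hq)
    rw [Real.norm_of_nonneg (hsNorm_nonneg _ _), map_add, map_add, map_add, add_sub_add_comm]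
    exact hsNorm_add_le _ _ _
  | monomial n c hq =>
    set q : Polynomial 𝕜 := .C c * .X ^ n
    have hXq : (.C c * .X ^ (n + 1) : Polynomial 𝕜) = .X * q := by ring
    have hqA : Polynomial.aeval A q ∈ almostInvariant l b :=
      Algebra.adjoin_le (by simpa using hA) (Polynomial.aeval_mem_adjoin_singleton 𝕜 A)
    refine (IsBigO.of_norm_le fun a => ?_).trans_isLittleO
      ((hqA.const_mul_left ‖A‖).add (hq.const_mul_left ‖A‖))
    rw [Real.norm_of_nonneg (hsNorm_nonneg _ _), hXq, map_mul _ .X q, map_mul _ .X q,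
      Polynomial.aeval_X, Polynomial.aeval_X]
    exact hsNorm_compress_mul_sub_mul_le (b a) A _ _

/-- Since `|Tr D| ≤ √(dim K) ‖D‖₂`, an error of size `o(√(dim K))` in the Hilbert–Schmidt norm is
invisible to the normalised trace. -/
theorem isLittleO_trace_aeval_compress_sub (hA : A ∈ almostInvariant l b) (p : Polynomial 𝕜) :
    (fun a => LinearMap.trace 𝕜 (K a)
      (compress (K a) (Polynomial.aeval A p) - Polynomial.aeval (compress (K a) A) p :
        K a →L[𝕜] K a)) =o[l] fun a => (Fintype.card (ι a) : ℝ) := by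
  have h := (isBigO_refl (fun a => √(Fintype.card (ι a))) l).mul_isLittleO
    (isLittleO_hsNorm_compress_aeval_sub hA p)
  simp only [Real.mul_self_sqrt (Nat.cast_nonneg _)] at h
  exact (IsBigO.of_norm_le fun a => norm_trace_le_hsNorm (b a) _).trans_isLittleO h

end AlmostInvariant

section PolynomialApproximation

lemma map_circleIntegral {E F : Type*} [NormedAddCommGroup E] [NormedSpace ℂ E] [CompleteSpace E]
    [NormedAddCommGroup F] [NormedSpace ℂ F] [CompleteSpace F] (L : E →L[ℂ] F) {g : ℂ → E}
    {c : ℂ} {R : ℝ} (hg : CircleIntegrable g c R) :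
    L (∮ z in C(c, R), g z) = ∮ z in C(c, R), L (g z) := by
  simp only [circleIntegral, ← L.intervalIntegral_comp_comm hg.out, map_smul]

lemma analyticAt_of_continuousOn_of_eval {X : Type*} [TopologicalSpace X] [CompactSpace X]
    {V : Set ℂ} (hV : IsOpen V) {γ : ℂ → C(X, ℂ)} (hγ : ContinuousOn γ V)
    (hγd : ∀ x, DifferentiableOn ℂ (fun t => γ t x) V) {t₀ : ℂ} (ht₀ : t₀ ∈ V) :
    AnalyticAt ℂ γ t₀ := by
  obtain ⟨R, hR, hRV⟩ := Metric.nhds_basis_closedBall.mem_iff.1 (hV.mem_nhds ht₀)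
  lift R to NNReal using hR.le
  have hγR : ContinuousOn γ (Metric.sphere t₀ R) :=
    hγ.mono (Metric.sphere_subset_closedBall.trans hRV)
  have hcauchy := (hasFPowerSeriesOn_cauchy_integral (hγR.circleIntegrable R.2)
    (by exact_mod_cast hR)).analyticAt
  refine hcauchy.congr ?_
  filter_upwards [Metric.ball_mem_nhds t₀ hR] with t ht
  have h_integrable : CircleIntegrable (fun z => (z - t)⁻¹ • γ z) t₀ R := by
    refine ContinuousOn.circleIntegrable R.2 (ContinuousOn.fun_smul
      (ContinuousOn.inv₀ (by fun_prop) fun z hz => sub_ne_zero.2 ?_) hγR)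
    rintro rfl
    exact (Metric.mem_ball.1 ht).ne hz
  ext x
  have hball : DiffContOnCl ℂ (fun t => γ t x) (Metric.ball t₀ R) :=
    ((hγd x).mono hRV).diffContOnCl_ball subset_rfl
  have heval := map_circleIntegral (ContinuousMap.evalCLM ℂ x) h_integrable
  simp only [ContinuousMap.evalCLM_apply, ContinuousMap.smul_apply] at heval
  rw [ContinuousMap.smul_apply, heval, hball.two_pi_i_inv_smul_circleIntegral_sub_inv_smul ht]

/-- The closure of the polynomials in `C(K)`. -/
def polynomialClosure (K : Set ℂ) [CompactSpace K] : Submodule ℂ C(K, ℂ) :=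
  Subalgebra.toSubmodule (polynomialFunctions K).topologicalClosure

instance (K : Set ℂ) [CompactSpace K] : IsClosed (polynomialClosure K : Set C(K, ℂ)) :=
  (polynomialFunctions K).isClosed_topologicalClosure

lemma mem_polynomialClosure_iff {K : Set ℂ} [CompactSpace K] {g : C(K, ℂ)} :
    g ∈ polynomialClosure K ↔
      ∀ ε : ℝ, 0 < ε → ∃ p : Polynomial ℂ, ∀ z : K, ‖g z - p.eval (z : ℂ)‖ < ε := by
  have hdist (p : Polynomial ℂ) {ε : ℝ} (hε : 0 < ε) :
      dist g (p.toContinuousMapOn K) < ε ↔ ∀ z : K, ‖g z - p.eval (z : ℂ)‖ < ε := by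
    rw [ContinuousMap.dist_lt_iff hε]
    simp [dist_eq_norm]
  refine Metric.mem_closure_iff.trans (forall₂_congr fun ε hε => ⟨?_, ?_⟩)
  · rintro ⟨_, ⟨p, -, rfl⟩, hp⟩
    exact ⟨p, (hdist p hε).1 hp⟩
  · rintro ⟨p, hp⟩
    exact ⟨p.toContinuousMapOn K, ⟨p, trivial, rfl⟩, (hdist p hε).2 hp⟩

variable {K U : Set ℂ} {c : ℂ} {f : ℂ → ℂ}

lemma isOpen_setOf_forall_dilation_mem (hK : IsCompact K) (hU : IsOpen U) :
    IsOpen {t : ℂ | ∀ z ∈ K, c + t * (z - c) ∈ U} := by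
  refine isOpen_iff_mem_nhds.2 fun t ht => ?_
  refine hK.eventually_forall_of_forall_eventually fun z hz => ?_
  have hcont : Continuous fun q : ℂ × ℂ => c + q.1 * (q.2 - c) := by fun_prop
  exact hcont.continuousAt.eventually (hU.mem_nhds (ht z hz))

lemma exists_continuousOn_dilation [CompactSpace K] (hf : ContinuousOn f U) :
    ∃ γ : ℂ → C(K, ℂ), ContinuousOn γ {t : ℂ | ∀ z ∈ K, c + t * (z - c) ∈ U} ∧
      ∀ t ∈ {t : ℂ | ∀ z ∈ K, c + t * (z - c) ∈ U}, ∀ z : K, γ t z = f (c + t * (z - c)) := by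
  classical
  set V : Set ℂ := {t | ∀ z ∈ K, c + t * (z - c) ∈ U}
  let G : C(V × K, ℂ) := ⟨fun q => f (c + q.1 * (q.2 - c)),
    hf.comp_continuous (by fun_prop) fun q => q.1.2 _ q.2.2⟩
  refine ⟨fun t => if ht : t ∈ V then G.curry ⟨t, ht⟩ else 0, ?_, fun t ht z => by simp [ht, G]⟩
  rw [continuousOn_iff_continuous_domRestrict]
  convert G.curry.continuous using 1
  ext1 t
  simp

lemma eventually_dilation_mem_polynomialClosure [CompactSpace K] (hf : AnalyticAt ℂ f c)
    {γ : ℂ → C(K, ℂ)} (hγ : ∀ᶠ t in 𝓝 0, ∀ z : K, γ t z = f (c + t * (z - c))) :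
    ∀ᶠ t in 𝓝 0, γ t ∈ polynomialClosure K := by
  obtain ⟨s, r, hs⟩ := hf
  obtain ⟨ρ, hρ, hρr⟩ := ENNReal.lt_iff_exists_nnreal_btwn.1 hs.r_pos
  have hunif := hs.tendstoUniformlyOn hρr
  have hsmall : ∀ᶠ t : ℂ in 𝓝 0, ∀ z ∈ K, t * (z - c) ∈ Metric.ball (0 : ℂ) ρ := by
    have hK : IsCompact K := isCompact_iff_compactSpace.2 inferInstance
    refine hK.eventually_forall_of_forall_eventually fun z _ => ?_
    have hcont : Continuous fun q : ℂ × ℂ => q.1 * (q.2 - c) := by fun_prop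
    exact hcont.continuousAt.eventually (Metric.isOpen_ball.mem_nhds (by simpa using hρ))
  filter_upwards [hγ, hsmall] with t hγt ht
  refine mem_polynomialClosure_iff.2 fun ε hε => ?_
  obtain ⟨n, hn⟩ := (Metric.tendstoUniformlyOn_iff.1 hunif ε hε).exists
  refine ⟨∑ k ∈ Finset.range n, .C (s.coeff k) * (.C t * (.X - .C c)) ^ k, fun z => ?_⟩
  refine lt_of_eq_of_lt ?_ (hn _ (ht z z.2))
  rw [hγt, dist_eq_norm]
  congr 2
  simp [FormalMultilinearSeries.partialSum, Polynomial.eval_finsetSum, mul_comm]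

/-- **Runge's theorem** for a compact star-shaped set. The dilations `t ↦ f (c + t (z - c))`,
`0 ≤ t ≤ 1`, depend analytically on `t` as elements of `C(K)` and are limits of polynomials for
small `t`, hence for all `t` by the identity principle in `C(K)` modulo the closed polynomials. -/
theorem exists_polynomial_near_of_differentiableOn (hK : IsCompact K) (hcK : c ∈ K)
    (hKc : StarConvex ℝ c K) (hU : IsOpen U) (hKU : K ⊆ U) (hf : DifferentiableOn ℂ f U)
    {ε : ℝ} (hε : 0 < ε) : ∃ p : Polynomial ℂ, ∀ z ∈ K, ‖f z - p.eval z‖ < ε := by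
  have : CompactSpace K := isCompact_iff_compactSpace.1 hK
  let V : Set ℂ := {t | ∀ z ∈ K, c + t * (z - c) ∈ U}
  have hV : IsOpen V := isOpen_setOf_forall_dilation_mem hK hU
  have hIV : segment ℝ 0 1 ⊆ V := by
    rw [segment_eq_image']
    rintro _ ⟨s, hs, rfl⟩ z hz
    refine hKU ?_
    simpa using hKc.add_smul_sub_mem hz hs.1 hs.2
  have h0 : (0 : ℂ) ∈ segment ℝ 0 1 := left_mem_segment ℝ 0 1
  have h1 : (1 : ℂ) ∈ segment ℝ 0 1 := right_mem_segment ℝ 0 1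
  obtain ⟨γ, hγ, hγV⟩ := exists_continuousOn_dilation (K := K) (c := c) hf.continuousOn
  have hγd (z : K) : DifferentiableOn ℂ (fun t => γ t z) V :=
    DifferentiableOn.congr (f := fun t : ℂ => f (c + t * (z - c)))
      (hf.comp (by fun_prop) fun t ht => ht z z.2) fun t ht => hγV t ht z
  let q := (polynomialClosure K).mkQL
  have han : AnalyticOnNhd ℂ (fun t => q (γ t)) (segment ℝ 0 1) := fun t ht =>
    (q.analyticAt _).comp (analyticAt_of_continuousOn_of_eval hV hγ hγd (hIV ht))
  have hzero : (fun t => q (γ t)) =ᶠ[𝓝 0] 0 := by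
    filter_upwards [eventually_dilation_mem_polynomialClosure
      (hf.analyticAt (hU.mem_nhds (hKU hcK)))
      (eventually_of_mem (hV.mem_nhds (hIV h0)) hγV)] with t ht
    exact (Submodule.Quotient.mk_eq_zero _).2 ht
  have hγ1 : γ 1 ∈ polynomialClosure K := (Submodule.Quotient.mk_eq_zero _).1
    (han.eqOn_zero_of_preconnected_of_eventuallyEq_zero (convex_segment 0 1).isPreconnected
      h0 hzero h1)
  obtain ⟨p, hp⟩ := mem_polynomialClosure_iff.1 hγ1 ε hε
  refine ⟨p, fun z hz => ?_⟩
  simpa [hγV 1 (hIV h1)] using hp ⟨z, hz⟩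

lemma exists_polynomial_near_of_continuousOn_Icc {a b : ℝ} {f : ℝ → ℂ}
    (hf : ContinuousOn f (Set.Icc a b)) {ε : ℝ} (hε : 0 < ε) :
    ∃ p : Polynomial ℂ, ∀ x ∈ Set.Icc a b, ‖f x - p.eval (x : ℂ)‖ < ε := by
  obtain ⟨p, hp⟩ := exists_polynomial_near_of_continuousOn a b (fun x => (f x).re)
    (Complex.continuous_re.comp_continuousOn hf) (ε / 2) (half_pos hε)
  obtain ⟨q, hq⟩ := exists_polynomial_near_of_continuousOn a b (fun x => (f x).im)
    (Complex.continuous_im.comp_continuousOn hf) (ε / 2) (half_pos hε)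
  have heval (r : Polynomial ℝ) (x : ℝ) :
      (r.map Complex.ofRealHom).eval (x : ℂ) = ((r.eval x : ℝ) : ℂ) := by
    rw [← Complex.ofRealHom_eq_coe, Polynomial.eval_map_apply, Complex.ofRealHom_eq_coe]
  refine ⟨p.map Complex.ofRealHom + .C Complex.I * q.map Complex.ofRealHom, fun x hx => ?_⟩
  refine (Complex.norm_le_abs_re_add_abs_im _).trans_lt ?_
  have hpx := hp x hx
  have hqx := hq x hx
  rw [abs_sub_comm] at hpx hqx
  simp only [Polynomial.eval_add, Polynomial.eval_mul, Polynomial.eval_C, heval,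
    Complex.sub_re, Complex.add_re, Complex.ofReal_re, Complex.mul_re, Complex.I_re, zero_mul,
    Complex.I_im, Complex.ofReal_im, mul_zero, sub_self, add_zero, Complex.sub_im, Complex.add_im,
    Complex.mul_im, one_mul, zero_add]
  linarith

end PolynomialApproximation

section TraceAeval

open Polynomial

variable {K : Type*} [Field K]

lemma exists_aeval_eq_resolvent {A : Type*} [Ring A] [Algebra K A] {a : A} {q : K[X]}
    (hq : aeval a q = 0) {z : K} (hz : q.eval z ≠ 0) :
    ∃ p : K[X], aeval a p = resolvent a z ∧ ∀ μ, q.eval μ = 0 → p.eval μ = (z - μ)⁻¹ := by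
  obtain ⟨p, r, bezout⟩ : IsCoprime (C z - X) q := by
    rw [← neg_sub, IsCoprime.neg_left_iff, (irreducible_X_sub_C z).coprime_iff_not_dvd]
    exact fun h => hz (dvd_iff_isRoot.1 h)
  have aeval_mul : aeval a p * (algebraMap K A z - a) = 1 := by
    simpa [hq] using congrArg (aeval a) bezout
  have mul_aeval : (algebraMap K A z - a) * aeval a p = 1 := by
    simpa [hq] using congrArg (aeval a) ((congrArg (· + r * q) (mul_comm _ p)).trans bezout)
  refine ⟨p, (Ring.inverse_unit ⟨_, _, mul_aeval, aeval_mul⟩).symm, fun μ hμ => ?_⟩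
  exact eq_inv_of_mul_eq_one_left (by simpa [hμ] using congrArg (eval μ) bezout)

variable [IsAlgClosed K] {V : Type*} [AddCommGroup V] [Module K V] [FiniteDimensional K V]

lemma card_roots_charpoly (f : Module.End K V) :
    f.charpoly.roots.card = Module.finrank K V := by
  rw [← (IsAlgClosed.splits f.charpoly).natDegree_eq_card_roots, f.charpoly_natDegree]

lemma det_aeval_eq_prod_roots_charpoly (f : Module.End K V) (p : K[X]) :
    LinearMap.det (aeval f p) = (f.charpoly.roots.map p.eval).prod := by
  have eval_charpoly (a : K) : f.charpoly.eval a = (f.charpoly.roots.map (a - ·)).prod :=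
    (IsAlgClosed.splits _).eval_eq_prod_roots_of_monic f.charpoly_monic a
  induction IsAlgClosed.splits p using Submonoid.closure_induction with
  | mem q hq =>
    rcases hq with ⟨a, rfl⟩ | ⟨a, rfl⟩
    · simp [Algebra.algebraMap_eq_smul_one, card_roots_charpoly]
    · have aeval_eq_neg : aeval f (X + C a) = -(algebraMap K _ (-a) - f) := by simp
      have eval_eq_neg (μ : K) : (X + C a).eval μ = -(-a - μ) := by simp [add_comm]
      simp only [aeval_eq_neg, eval_eq_neg]
      rw [← neg_one_smul K, LinearMap.det_smul, ← LinearMap.eval_charpoly, eval_charpoly,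
        ← card_roots_charpoly f]
      simp only [neg_eq_neg_one_mul (_ - _), Multiset.prod_map_mul, Multiset.map_const',
        Multiset.prod_replicate]
  | one => simp
  | mul p q _ _ hp hq => simp only [map_mul, hp, hq, eval_mul, Multiset.prod_map_mul]

lemma roots_charpoly_aeval (f : Module.End K V) (p : K[X]) :
    (aeval f p).charpoly.roots = f.charpoly.roots.map p.eval := by
  suffices h : (aeval f p).charpoly = ((f.charpoly.roots.map p.eval).map (X - C ·)).prod by
    rw [h, roots_multiset_prod_X_sub_C]
  refine Polynomial.funext fun x => ?_
  have aeval_C_sub : algebraMap K _ x - aeval f p = aeval f (C x - p) := by simp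
  rw [LinearMap.eval_charpoly, aeval_C_sub, det_aeval_eq_prod_roots_charpoly,
    eval_multiset_prod]
  simp

lemma trace_aeval_eq_sum_roots_charpoly (f : Module.End K V) (p : K[X]) :
    LinearMap.trace K V (aeval f p) = (f.charpoly.roots.map p.eval).sum := by
  rw [Module.End.trace_eq_sum_roots_charpoly_of_splits (IsAlgClosed.splits _),
    roots_charpoly_aeval]

end TraceAeval

section HolomorphicTrace

lemma exists_closedBall_subset_of_finite {X : Type*} [MetricSpace X] {σ U : Set X}
    (hσ : σ.Finite) (hU : IsOpen U) (hσU : σ ⊆ U) :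
    ∃ R > 0, ∀ x ∈ σ, Metric.closedBall x R ⊆ U ∧ Metric.closedBall x R ∩ σ ⊆ {x} := by
  have eventually_subset : ∀ᶠ r in 𝓝[>] (0 : ℝ), ∀ x ∈ σ,
      Metric.closedBall x r ⊆ U ∩ (σ \ {x})ᶜ := by
    refine (Filter.eventually_all_finite hσ).2 fun x hx => ?_
    have isOpen_inter : IsOpen (U ∩ (σ \ {x})ᶜ) :=
      hU.inter (hσ.subset Set.sdiff_subset).isClosed.isOpen_compl
    exact (eventually_closedBall_subset (isOpen_inter.mem_nhds ⟨hσU hx, by simp⟩)).filter_mono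
      nhdsWithin_le_nhds
  obtain ⟨R, hR, hR0⟩ := (eventually_subset.and self_mem_nhdsWithin).exists
  refine ⟨R, hR0, fun x hx => ⟨fun y hy => (hR x hx hy).1, fun y hy => ?_⟩⟩
  by_contra hyx
  exact (hR x hx hy.1).2 ⟨hy.2, hyx⟩

section Contour

variable {A : Type*} [NormedRing A] [NormedAlgebra ℂ A] [CompleteSpace A] {T : A} {f : ℂ → ℂ}

lemma differentiableAt_smul_resolvent {z : ℂ} (hf : DifferentiableAt ℂ f z)
    (hz : z ∉ spectrum ℂ T) : DifferentiableAt ℂ (fun z => f z • resolvent T z) z :=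
  hf.smul (spectrum.hasDerivAt_resolvent_const_left (by simpa [spectrum] using hz)).differentiableAt

lemma holFC_eq_of_closedBall_inter_spectrum_subset {U : Set ℂ} (hU : IsOpen U)
    (hf : DifferentiableOn ℂ f U) {R : ℝ} (hR : 0 < R)
    (hRT : ∀ μ ∈ spectrum ℂ T, Metric.closedBall μ R ⊆ U ∧
      Metric.closedBall μ R ∩ spectrum ℂ T ⊆ {μ}) :
    holFC f T = (2 * (Real.pi : ℂ) * Complex.I)⁻¹ •
      ∑ᶠ μ ∈ spectrum ℂ T, ∮ z in C(μ, R), f z • resolvent T z := by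
  have differentiableAt {μ : ℂ} (hμ : μ ∈ spectrum ℂ T) {z : ℂ}
      (hz : z ∈ Metric.closedBall μ R) (hzμ : z ≠ μ) :
      DifferentiableAt ℂ (fun z => f z • resolvent T z) z :=
    differentiableAt_smul_resolvent (hf.differentiableAt (hU.mem_nhds ((hRT μ hμ).1 hz)))
      fun h => hzμ ((hRT μ hμ).2 ⟨hz, h⟩)
  refine (tendsto_const_nhds.congr' ?_).limUnder_eq
  filter_upwards [Ioc_mem_nhdsGT hR] with r hr
  congr 1
  refine finsum_mem_congr rfl fun μ hμ =>
    Complex.circleIntegral_eq_of_differentiable_on_annulus_off_countable hr.1 hr.2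
      Set.countable_empty (fun z hz => ?_) fun z hz => ?_
  · refine (differentiableAt hμ hz.1 ?_).continuousAt.continuousWithinAt
    rintro rfl
    exact hz.2 (Metric.mem_ball_self hr.1)
  · refine differentiableAt hμ (Metric.ball_subset_closedBall hz.1.1) ?_
    rintro rfl
    exact hz.1.2 (Metric.mem_closedBall_self hr.1.le)

lemma circleIntegrable_smul_resolvent {U : Set ℂ} (hU : IsOpen U) (hf : DifferentiableOn ℂ f U)
    {c : ℂ} {R : ℝ} (hR : 0 ≤ R) (hRU : Metric.sphere c R ⊆ U)
    (hRT : ∀ z ∈ Metric.sphere c R, z ∉ spectrum ℂ T) :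
    CircleIntegrable (fun z => f z • resolvent T z) c R :=
  ContinuousOn.circleIntegrable hR fun z hz => (differentiableAt_smul_resolvent
    (hf.differentiableAt (hU.mem_nhds (hRU hz))) (hRT z hz)).continuousAt.continuousWithinAt

end Contour

lemma circleIntegral_sub_inv_mul_eq_ite {f : ℂ → ℂ} {c w : ℂ} {R : ℝ} (hR : 0 < R)
    (hf : DifferentiableOn ℂ f (Metric.closedBall c R))
    (hw : w ∈ Metric.closedBall c R → w = c) :
    (∮ z in C(c, R), (z - w)⁻¹ * f z) =
      if w = c then 2 * (Real.pi : ℂ) * Complex.I * f c else 0 := by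
  split_ifs with h
  · rw [h]
    exact hf.circleIntegral_sub_inv_smul (Metric.mem_ball_self hR)
  · have differentiableOn : DifferentiableOn ℂ (fun z => (z - w)⁻¹ * f z)
        (Metric.closedBall c R) := by
      refine DifferentiableOn.fun_mul (DifferentiableOn.fun_inv (by fun_prop) fun z hz h0 => ?_) hf
      exact h (hw (sub_eq_zero.1 h0 ▸ hz))
    exact (differentiableOn.diffContOnCl_ball subset_rfl).circleIntegral_eq_zero hR.le

variable {E : Type*} [NormedAddCommGroup E] [NormedSpace ℂ E] [FiniteDimensional ℂ E]

/-- The eigenvalues of an operator, each repeated according to its algebraic multiplicity. -/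
def eigenvalues (T : E →L[ℂ] E) : Multiset ℂ := (T : E →ₗ[ℂ] E).charpoly.roots

lemma mem_eigenvalues {T : E →L[ℂ] E} {μ : ℂ} : μ ∈ eigenvalues T ↔ μ ∈ spectrum ℂ T := by
  rw [eigenvalues, Polynomial.mem_roots (LinearMap.charpoly_monic _).ne_zero,
    ← Module.End.mem_spectrum_iff_isRoot_charpoly]
  exact Set.ext_iff.1 (AlgEquiv.spectrum_eq (Module.End.toContinuousLinearMap E).symm T) μ

lemma card_eigenvalues (T : E →L[ℂ] E) : (eigenvalues T).card = Module.finrank ℂ E :=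
  card_roots_charpoly _

lemma finite_spectrum (T : E →L[ℂ] E) : (spectrum ℂ T).Finite :=
  (eigenvalues T).finite_toSet.subset fun _ => mem_eigenvalues.2

lemma coe_aeval (T : E →L[ℂ] E) (p : Polynomial ℂ) :
    ((Polynomial.aeval T p : E →L[ℂ] E) : E →ₗ[ℂ] E) = Polynomial.aeval (T : E →ₗ[ℂ] E) p :=
  (Polynomial.aeval_algHom_apply (Module.End.toContinuousLinearMap E).symm T p).symm

lemma tr_aeval (T : E →L[ℂ] E) (p : Polynomial ℂ) :
    tr (Polynomial.aeval T p) = ((eigenvalues T).map p.eval).sum := by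
  rw [tr, coe_aeval, trace_aeval_eq_sum_roots_charpoly]
  rfl

lemma tr_resolvent {T : E →L[ℂ] E} {z : ℂ} (hz : z ∉ spectrum ℂ T) :
    tr (resolvent T z) = ((eigenvalues T).map fun μ => (z - μ)⁻¹).sum := by
  have charpoly_ne_zero : (T : E →ₗ[ℂ] E).charpoly ≠ 0 := (LinearMap.charpoly_monic _).ne_zero
  obtain ⟨p, hp, eval_eq⟩ := exists_aeval_eq_resolvent (a := T) (z := z)
    (q := (T : E →ₗ[ℂ] E).charpoly)
    (ContinuousLinearMap.coe_injective <| (coe_aeval T _).trans (LinearMap.aeval_self_charpoly _))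
    fun h => hz (mem_eigenvalues.1 ((Polynomial.mem_roots charpoly_ne_zero).2 h))
  rw [← hp, tr_aeval]
  exact congrArg _ <| Multiset.map_congr rfl fun μ hμ =>
    eval_eq μ (Polynomial.isRoot_of_mem_roots hμ)

/-- The trace as a continuous linear functional, so that it commutes with contour integrals. -/
def trCLM (E : Type*) [NormedAddCommGroup E] [NormedSpace ℂ E] [FiniteDimensional ℂ E] :
    (E →L[ℂ] E) →L[ℂ] ℂ :=
  LinearMap.toContinuousLinearMap
    (LinearMap.trace ℂ E ∘ₗ (Module.End.toContinuousLinearMap E).symm.toLinearMap)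

lemma trCLM_apply (S : E →L[ℂ] E) : trCLM E S = tr S := rfl

lemma tr_smul_resolvent_eq_sum_count {T : E →L[ℂ] E} {z : ℂ} (hz : z ∉ spectrum ℂ T) (w : ℂ) :
    tr (w • resolvent T z) = ∑ μ ∈ (eigenvalues T).toFinset,
      (eigenvalues T).count μ • ((z - μ)⁻¹ * w) := by
  rw [← trCLM_apply, map_smul, trCLM_apply, tr_resolvent hz, Finset.sum_multiset_map_count,
    Finset.smul_sum]
  simp only [smul_eq_mul, nsmul_eq_mul, mul_comm w, mul_assoc]

lemma tr_circleIntegral_smul_resolvent {T : E →L[ℂ] E} {f : ℂ → ℂ} {U : Set ℂ} (hU : IsOpen U)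
    (hf : DifferentiableOn ℂ f U) {c : ℂ} (hc : c ∈ spectrum ℂ T) {R : ℝ} (hR : 0 < R)
    (hRU : Metric.closedBall c R ⊆ U) (hRT : Metric.closedBall c R ∩ spectrum ℂ T ⊆ {c}) :
    tr (∮ z in C(c, R), f z • resolvent T z) =
      (eigenvalues T).count c • (2 * (Real.pi : ℂ) * Complex.I * f c) := by
  have : CompleteSpace E := FiniteDimensional.complete ℂ E
  have notMem_spectrum {z : ℂ} (hz : z ∈ Metric.sphere c R) : z ∉ spectrum ℂ T := fun h =>
    Metric.ne_of_mem_sphere hz hR.ne' (hRT ⟨Metric.sphere_subset_closedBall hz, h⟩)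
  have mem_spectrum {μ : ℂ} (hμ : μ ∈ (eigenvalues T).toFinset) : μ ∈ spectrum ℂ T :=
    mem_eigenvalues.1 (Multiset.mem_toFinset.1 hμ)
  have circleIntegrable_term (μ : ℂ) (hμ : μ ∈ (eigenvalues T).toFinset) :
      CircleIntegrable (fun z => (eigenvalues T).count μ • ((z - μ)⁻¹ * f z)) c R := by
    refine ContinuousOn.circleIntegrable hR.le (ContinuousOn.fun_const_smul
      (ContinuousOn.fun_mul (ContinuousOn.fun_inv₀ (by fun_prop) fun z hz h => ?_)
        (hf.continuousOn.mono (Metric.sphere_subset_closedBall.trans hRU))) _)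
    exact notMem_spectrum hz (sub_eq_zero.1 h ▸ mem_spectrum hμ)
  have integral_term (μ : ℂ) (hμ : μ ∈ (eigenvalues T).toFinset) :
      (∮ z in C(c, R), (eigenvalues T).count μ • ((z - μ)⁻¹ * f z)) =
        if μ = c then (eigenvalues T).count μ • (2 * (Real.pi : ℂ) * Complex.I * f c) else 0 := by
    simp only [nsmul_eq_mul, circleIntegral.integral_const_mul]
    rw [circleIntegral_sub_inv_mul_eq_ite hR (hf.mono hRU) fun h => hRT ⟨h, mem_spectrum hμ⟩,
      mul_ite, mul_zero]
  calc tr (∮ z in C(c, R), f z • resolvent T z)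
      = ∮ z in C(c, R), tr (f z • resolvent T z) := map_circleIntegral (trCLM E) <|
        circleIntegrable_smul_resolvent hU hf hR.le
          (Metric.sphere_subset_closedBall.trans hRU) fun _ => notMem_spectrum
    _ = ∮ z in C(c, R), ∑ μ ∈ (eigenvalues T).toFinset,
          (eigenvalues T).count μ • ((z - μ)⁻¹ * f z) :=
        circleIntegral.integral_congr hR.le fun z hz =>
          tr_smul_resolvent_eq_sum_count (notMem_spectrum hz) (f z)
    _ = ∑ μ ∈ (eigenvalues T).toFinset, ∮ z in C(c, R),
          (eigenvalues T).count μ • ((z - μ)⁻¹ * f z) :=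
        circleIntegral.integral_fun_sum circleIntegrable_term
    _ = (eigenvalues T).count c • (2 * (Real.pi : ℂ) * Complex.I * f c) := by
        rw [Finset.sum_congr rfl integral_term, Finset.sum_ite_eq',
          if_pos (Multiset.mem_toFinset.2 (mem_eigenvalues.2 hc))]

theorem tr_holFC (T : E →L[ℂ] E) {f : ℂ → ℂ} {U : Set ℂ} (hU : IsOpen U)
    (hf : DifferentiableOn ℂ f U) (hT : spectrum ℂ T ⊆ U) :
    tr (holFC f T) = ((eigenvalues T).map f).sum := by
  have : CompleteSpace E := FiniteDimensional.complete ℂ E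
  obtain ⟨R, hR, hRT⟩ := exists_closedBall_subset_of_finite (finite_spectrum T) hU hT
  have toFinset_spectrum : (finite_spectrum T).toFinset = (eigenvalues T).toFinset := by
    ext μ
    simp only [Set.Finite.mem_toFinset, Multiset.mem_toFinset, mem_eigenvalues]
  rw [holFC_eq_of_closedBall_inter_spectrum_subset hU hf hR hRT,
    finsum_mem_eq_finite_toFinset_sum _ (finite_spectrum T), ← trCLM_apply, map_smul, map_sum,
    Finset.sum_multiset_map_count, smul_eq_mul, Finset.mul_sum, toFinset_spectrum]
  refine Finset.sum_congr rfl fun μ hμ => ?_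
  replace hμ : μ ∈ spectrum ℂ T := mem_eigenvalues.1 (Multiset.mem_toFinset.1 hμ)
  rw [trCLM_apply, tr_circleIntegral_smul_resolvent hU hf hμ hR (hRT μ hμ).1 (hRT μ hμ).2,
    mul_smul_comm, inv_mul_cancel_left₀ Complex.two_pi_I_ne_zero]

lemma norm_tr_holFC_sub_le (T : E →L[ℂ] E) {f : ℂ → ℂ} {U : Set ℂ} (hU : IsOpen U)
    (hf : DifferentiableOn ℂ f U) (hT : spectrum ℂ T ⊆ U) (p : Polynomial ℂ) {ε : ℝ}
    (hp : ∀ z ∈ spectrum ℂ T, ‖f z - p.eval z‖ ≤ ε) :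
    ‖tr (holFC f T) - tr (Polynomial.aeval T p)‖ ≤ Module.finrank ℂ E * ε := by
  rw [tr_holFC T hU hf hT, tr_aeval, ← Multiset.sum_map_sub, ← card_eigenvalues T,
    ← nsmul_eq_mul]
  refine (norm_multiset_sum_le _).trans ?_
  rw [Multiset.map_map, ← Multiset.card_map fun z => ‖f z - p.eval z‖]
  refine Multiset.sum_le_card_nsmul _ _ fun x hx => ?_
  obtain ⟨z, hz, rfl⟩ := Multiset.mem_map.1 hx
  exact hp z (mem_eigenvalues.1 hz)

end HolomorphicTrace

section ContinuousTrace

variable {E : Type*} [NormedAddCommGroup E] [InnerProductSpace ℂ E]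

lemma exists_inner_eq_of_mem_spectrum [FiniteDimensional ℂ E] {T : E →L[ℂ] E} {z : ℂ}
    (hz : z ∈ spectrum ℂ T) : ∃ u : E, ‖u‖ = 1 ∧ inner ℂ u (T u) = z := by
  have hasEigenvalue : Module.End.HasEigenvalue (T : E →ₗ[ℂ] E) z := by
    rwa [Module.End.hasEigenvalue_iff_mem_spectrum,
      ← AlgEquiv.spectrum_eq (Module.End.toContinuousLinearMap E)]
  obtain ⟨v, hv⟩ := hasEigenvalue.exists_hasEigenvector
  have apply_eq : T v = z • v := hv.apply_eq_smul
  have norm_eq_one : ‖(‖v‖⁻¹ : ℂ) • v‖ = 1 := norm_smul_inv_norm hv.2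
  refine ⟨(‖v‖⁻¹ : ℂ) • v, norm_eq_one, ?_⟩
  rw [map_smul, apply_eq, smul_comm, inner_smul_right,
    inner_self_eq_one_of_norm_eq_one norm_eq_one, mul_one]

lemma norm_tr_contFC_sub_le {ι : Type*} [Fintype ι] [CompleteSpace E]
    (b : OrthonormalBasis ι ℂ E) {T : E →L[ℂ] E} (hT : IsStarNormal T) {f : ℝ → ℂ}
    (hf : ContinuousOn (fun z : ℂ => f z.re) (spectrum ℂ T)) (p : Polynomial ℂ) {ε : ℝ}
    (hε : 0 ≤ ε) (hp : ∀ z ∈ spectrum ℂ T, ‖f z.re - p.eval z‖ ≤ ε) :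
    ‖tr (contFC f T) - tr (Polynomial.aeval T p)‖ ≤ Fintype.card ι * ε := by
  have contFC_sub_aeval : contFC f T - Polynomial.aeval T p =
      cfc (p := IsStarNormal) (fun z : ℂ => f z.re - p.eval z) T := by
    rw [cfc_sub _ _ _ hf p.continuous.continuousOn, cfc_polynomial p _ hT, contFC]
  calc ‖tr (contFC f T) - tr (Polynomial.aeval T p)‖
      = ‖tr (contFC f T - Polynomial.aeval T p)‖ := by
        rw [tr, tr, tr, ContinuousLinearMap.toLinearMap_sub, map_sub]
    _ ≤ Fintype.card ι * ‖contFC f T - Polynomial.aeval T p‖ := norm_trace_le_opNorm b _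
    _ ≤ Fintype.card ι * ε := by
        rw [contFC_sub_aeval]
        gcongr
        exact norm_cfc_le hε hp

end ContinuousTrace

section Multiplication

lemma coeFn_mulOp (φ : Linf) (u : L2) : mulOp φ u =ᵐ[m] fun t => φ t * u t :=
  (ContinuousLinearMap.mul ℂ ℂ).coeFn_holder φ u

/-- Multiplication by a continuous function, as an operator on `L²(𝕋)` depending linearly and
continuously on the function. -/
def mulC : C(𝕋, ℂ) →L[ℂ] (L2 →L[ℂ] L2) :=
  (ContinuousLinearMap.mul ℂ ℂ).holderL m ∞ 2 2 ∘L ContinuousMap.toLp ∞ m ℂ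

lemma coeFn_mulC (F : C(𝕋, ℂ)) (u : L2) : mulC F u =ᵐ[m] fun t => F t * u t := by
  filter_upwards [coeFn_mulOp (ContinuousMap.toLp ∞ m ℂ F) u,
    ContinuousMap.coeFn_toLp (p := ∞) (𝕜 := ℂ) m F] with t h_mul h_coe
  rw [← h_coe]
  exact h_mul

lemma mulC_mul (F G : C(𝕋, ℂ)) : mulC (F * G) = mulC F * mulC G := by
  ext1 u
  refine Lp.ext ?_
  filter_upwards [coeFn_mulC (F * G) u, coeFn_mulC F (mulC G u), coeFn_mulC G u]
    with t h_FG h_F h_G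
  rw [h_FG, mul_apply_eq_comp, h_F, h_G, ContinuousMap.mul_apply, mul_assoc]

lemma mulC_mul_apply (F G : C(𝕋, ℂ)) (u : L2) : mulC (F * G) u = mulC F (mulC G u) := by
  rw [mulC_mul, mul_apply_eq_comp]

@[simp]
lemma mulC_one : mulC 1 = 1 := by
  ext1 u
  refine Lp.ext ?_
  filter_upwards [coeFn_mulC 1 u] with t ht
  simp [ht]

lemma mulC_left_comm (F G : C(𝕋, ℂ)) (u : L2) : mulC F (mulC G u) = mulC G (mulC F u) := by
  rw [← mulC_mul_apply, mul_comm, mulC_mul_apply]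

lemma inner_mulC_left (F : C(𝕋, ℂ)) (u v : L2) :
    inner ℂ (mulC F u) v = inner ℂ u (mulC (star F) v) := by
  rw [L2.inner_def, L2.inner_def]
  refine integral_congr_ae ?_
  filter_upwards [coeFn_mulC F u, coeFn_mulC (star F) v] with t hu hv
  rw [hu, hv]
  simp only [RCLike.inner_apply, map_mul, ContinuousMap.star_apply, RCLike.star_def]
  ring

lemma mulC_star_mulC {F : C(𝕋, ℂ)} (hF : F ∈ unitary C(𝕋, ℂ)) (u : L2) :
    mulC (star F) (mulC F u) = u := by
  rw [← mulC_mul_apply, Unitary.star_mul_self_of_mem hF, mulC_one, one_apply_eq_self]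

lemma inner_mulC_mulC {F : C(𝕋, ℂ)} (hF : F ∈ unitary C(𝕋, ℂ)) (u v : L2) :
    inner ℂ (mulC F u) (mulC F v) = inner ℂ u v := by
  rw [inner_mulC_left, mulC_star_mulC hF]

lemma norm_mulC_apply {F : C(𝕋, ℂ)} (hF : F ∈ unitary C(𝕋, ℂ)) (u : L2) :
    ‖mulC F u‖ = ‖u‖ := by
  rw [norm_eq_sqrt_re_inner (𝕜 := ℂ), inner_mulC_mulC hF, ← norm_eq_sqrt_re_inner]

lemma star_fourier (n : ℤ) : star (fourier n : C(𝕋, ℂ)) = fourier (-n) := by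
  ext t
  simp

lemma fourier_mem_unitary (n : ℤ) : (fourier n : C(𝕋, ℂ)) ∈ unitary C(𝕋, ℂ) := by
  rw [Unitary.mem_iff_star_mul_self, star_fourier]
  ext t
  rw [ContinuousMap.mul_apply, ← fourier_add, neg_add_cancel, fourier_zero, ContinuousMap.one_apply]

/-- The monomial `ζⁿ` as an element of `L²(𝕋)`. -/
def monomial (n : ℤ) : L2 := fourierBasis n

lemma coeFn_monomial (n : ℤ) : monomial n =ᵐ[m] fourier n := by
  rw [monomial, coe_fourierBasis]
  exact coeFn_fourierLp 2 n

lemma inner_monomial (i j : ℤ) :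
    inner ℂ (monomial i) (monomial j) = if i = j then 1 else 0 :=
  orthonormal_iff_ite.1 (fourierBasis (T := 1)).orthonormal i j

@[simp]
lemma norm_monomial (n : ℤ) : ‖monomial n‖ = 1 := (fourierBasis (T := 1)).orthonormal.1 n

lemma ext_of_inner_monomial {u v : L2}
    (h : ∀ n, inner ℂ (monomial n) u = inner ℂ (monomial n) v) : u = v := by
  refine (fourierBasis (T := 1)).repr.injective (lp.ext (funext fun n => ?_))
  simp only [HilbertBasis.repr_apply_apply]
  exact h n

lemma mulC_fourier_monomial (k n : ℤ) : mulC (fourier k) (monomial n) = monomial (n + k) := by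
  refine Lp.ext ?_
  filter_upwards [coeFn_mulC (fourier k) (monomial n), coeFn_monomial n, coeFn_monomial (n + k)]
    with t h_mul h_n h_add
  rw [h_mul, h_n, h_add, fourier_add, mul_comm]

lemma inner_monomial_mulC_fourier (n k : ℤ) (u : L2) :
    inner ℂ (monomial n) (mulC (fourier k) u) = inner ℂ (monomial (n - k)) u := by
  rw [← neg_neg k, ← star_fourier, ← inner_mulC_left, mulC_fourier_monomial, neg_neg,
    sub_eq_add_neg]

end Multiplication

section Hardy

lemma mem_hardy_iff {u : L2} : u ∈ hardy ↔ ∀ n : ℤ, n < 0 → inner ℂ (monomial n) u = 0 := by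
  refine forall_congr' fun n => forall_congr' fun _ => ?_
  rw [← fourierBasis_repr, HilbertBasis.repr_apply_apply, monomial]

lemma inner_monomial_of_mem_hardy {u : L2} (hu : u ∈ hardy) {n : ℤ} (hn : n < 0) :
    inner ℂ (monomial n) u = 0 :=
  mem_hardy_iff.1 hu n hn

instance : CompleteSpace hardy := isClosed_hardy.completeSpace_coe

lemma monomial_mem_hardy {n : ℤ} (hn : 0 ≤ n) : monomial n ∈ hardy :=
  mem_hardy_iff.2 fun k hk => by rw [inner_monomial, if_neg (hk.trans_le hn).ne]

lemma backwardShift_mem_hardy {u : L2} (hu : u ∈ hardy) :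
    mulC (fourier (-1)) u - inner ℂ (monomial 0) u • monomial (-1) ∈ hardy := by
  refine mem_hardy_iff.2 fun n hn => ?_
  rw [inner_sub_right, inner_smul_right, inner_monomial_mulC_fourier, inner_monomial,
    sub_neg_eq_add]
  split_ifs with h
  · simp [h]
  · simp [inner_monomial_of_mem_hardy hu (n := n + 1) (by omega)]

/-- The continuous functions `F` with `F H² ⊆ H²` (they form the disk algebra). -/
def multiplier : Subalgebra ℂ C(𝕋, ℂ) where
  carrier := {F | ∀ u ∈ hardy, mulC F u ∈ hardy}
  mul_mem' hF hG u hu := by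
    rw [mulC_mul_apply]
    exact hF _ (hG _ hu)
  add_mem' hF hG u hu := by
    rw [map_add]
    exact hardy.add_mem (hF u hu) (hG u hu)
  algebraMap_mem' c u hu := by
    rw [Algebra.algebraMap_eq_smul_one, map_smul, mulC_one]
    exact hardy.smul_mem c hu

lemma mem_multiplier {F : C(𝕋, ℂ)} : F ∈ multiplier ↔ ∀ u ∈ hardy, mulC F u ∈ hardy := Iff.rfl

lemma isClosed_multiplier : IsClosed (multiplier : Set C(𝕋, ℂ)) := by
  have h_inter : (multiplier : Set C(𝕋, ℂ)) = ⋂ u ∈ hardy, {F | mulC F u ∈ hardy} := by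
    ext F
    simp [mem_multiplier]
  rw [h_inter]
  exact isClosed_biInter fun u _ => isClosed_hardy.preimage (by fun_prop)

lemma fourier_one_mem_multiplier : (fourier 1 : C(𝕋, ℂ)) ∈ multiplier := by
  intro u hu
  refine mem_hardy_iff.2 fun n hn => ?_
  rw [inner_monomial_mulC_fourier]
  exact inner_monomial_of_mem_hardy hu (by omega)

/-- The inner functions that are continuous on the circle. -/
def innerFunction : Submonoid C(𝕋, ℂ) := multiplier.toSubmonoid ⊓ unitary C(𝕋, ℂ)

end Hardy

section ModelSpace

variable {B b : C(𝕋, ℂ)}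

lemma mem_mulHardy_iff {h : L2} : h ∈ mulHardy B ↔ ∃ g ∈ hardy, mulC B g = h := by
  refine exists_congr fun g => and_congr_right fun _ => ⟨fun e => Lp.ext ?_, fun e => ?_⟩
  · exact (coeFn_mulC B g).trans e.symm
  · exact e ▸ coeFn_mulC B g

lemma mem_modelSpace_iff {h : L2} :
    h ∈ modelSpace B ↔ h ∈ hardy ∧ ∀ g ∈ hardy, inner ℂ (mulC B g) h = 0 := by
  refine and_congr_right fun _ => ?_
  simp only [SetLike.mem_coe, Submodule.mem_orthogonal, mem_mulHardy_iff, forall_exists_index,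
    and_imp, forall_apply_eq_imp_iff₂]

lemma mulC_mem_orthogonal_modelSpace {g : L2} (hg : g ∈ hardy) : mulC B g ∈ (modelSpace B)ᗮ :=
  (Submodule.mem_orthogonal' _ _).2 fun _ hu => (mem_modelSpace_iff.1 hu).2 g hg

lemma orthogonal_hardy_le : hardyᗮ ≤ (modelSpace B)ᗮ := Submodule.orthogonal_le inf_le_left

lemma monomial_mem_orthogonal_hardy {n : ℤ} (hn : n < 0) : monomial n ∈ hardyᗮ :=
  (Submodule.mem_orthogonal' _ _).2 fun _ hu => inner_monomial_of_mem_hardy hu hn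

lemma modelSpace_one : modelSpace (1 : C(𝕋, ℂ)) = ⊥ := by
  refine (Submodule.eq_bot_iff _).2 fun h hh => ?_
  obtain ⟨h_hardy, h_orth⟩ := mem_modelSpace_iff.1 hh
  simpa using h_orth h h_hardy

lemma modelSpace_le_modelSpace_mul (hb : b ∈ multiplier) :
    modelSpace B ≤ modelSpace (B * b : C(𝕋, ℂ)) := by
  intro h hh
  obtain ⟨h_hardy, h_orth⟩ := mem_modelSpace_iff.1 hh
  refine mem_modelSpace_iff.2 ⟨h_hardy, fun g hg => ?_⟩
  rw [mulC_mul_apply]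
  exact h_orth _ (hb g hg)

lemma mulC_mem_modelSpace_mul (hB : B ∈ innerFunction) {h : L2} (hh : h ∈ modelSpace b) :
    mulC B h ∈ modelSpace (B * b : C(𝕋, ℂ)) := by
  obtain ⟨h_hardy, h_orth⟩ := mem_modelSpace_iff.1 hh
  refine mem_modelSpace_iff.2 ⟨hB.1 h h_hardy, fun g hg => ?_⟩
  rw [mulC_mul_apply, inner_mulC_mulC hB.2]
  exact h_orth g hg

theorem modelSpace_mul (hB : B ∈ innerFunction) (hb : b ∈ multiplier) :
    modelSpace (B * b : C(𝕋, ℂ)) = modelSpace B ⊔ (modelSpace b).map (mulC B : L2 →ₗ[ℂ] L2) := by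
  refine le_antisymm (fun h hh => ?_) (sup_le (modelSpace_le_modelSpace_mul hb)
    (Submodule.map_le_iff_le_comap.2 fun g hg => mulC_mem_modelSpace_mul hB hg))
  obtain ⟨h_hardy, h_orth⟩ := mem_modelSpace_iff.1 hh
  -- The component of `h` in `B K_b` is its projection onto `B H²`.
  set g : L2 := hardy.starProjection (mulC (star B) h) with hg_def
  have hg : g ∈ hardy := hardy.starProjection_apply_mem _
  have inner_g {f : L2} (hf : f ∈ hardy) : inner ℂ f g = inner ℂ (mulC B f) h := by
    rw [hg_def, ← hardy.inner_starProjection_left_eq_right,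
      Submodule.starProjection_eq_self_iff.2 hf, inner_mulC_left]
  have h_sub : h - mulC B g ∈ modelSpace B := by
    refine mem_modelSpace_iff.2 ⟨hardy.sub_mem h_hardy (hB.1 g hg), fun f hf => ?_⟩
    rw [inner_sub_right, inner_mulC_mulC hB.2, inner_g hf, sub_self]
  have hg_model : g ∈ modelSpace b := by
    refine mem_modelSpace_iff.2 ⟨hg, fun f hf => ?_⟩
    rw [inner_g (hb f hf), ← mulC_mul_apply]
    exact h_orth f hf
  rw [← sub_add_cancel h (mulC B g)]
  exact Submodule.add_mem_sup h_sub (Submodule.mem_map_of_mem hg_model)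

lemma mulC_fourier_one_sub_mem_modelSpace (hB : B ∈ innerFunction) {x : L2}
    (hx : x ∈ modelSpace B) :
    mulC (fourier 1) x -
      inner ℂ (mulC B (monomial 0)) (mulC (fourier 1) x) • mulC B (monomial 0) ∈ modelSpace B := by
  have h_one : monomial 0 ∈ hardy := monomial_mem_hardy le_rfl
  obtain ⟨hx_hardy, hx_orth⟩ := mem_modelSpace_iff.1 hx
  refine mem_modelSpace_iff.2 ⟨hardy.sub_mem (fourier_one_mem_multiplier _ hx_hardy)
    (hardy.smul_mem _ (hB.1 _ h_one)), fun g hg => ?_⟩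
  set g₁ := mulC (fourier (-1)) g - inner ℂ (monomial 0) g • monomial (-1) with hg₁_def
  have g_eq : g = inner ℂ (monomial 0) g • monomial 0 + mulC (fourier 1) g₁ := by
    rw [hg₁_def, map_sub, map_smul, mulC_fourier_monomial, mulC_left_comm, ← star_fourier,
      mulC_star_mulC (fourier_mem_unitary 1)]
    simp
  have inner_shift : inner ℂ (mulC B (mulC (fourier 1) g₁)) (mulC (fourier 1) x) = 0 := by
    rw [mulC_left_comm, inner_mulC_mulC (fourier_mem_unitary 1)]
    exact hx_orth _ (backwardShift_mem_hardy hg)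
  have inner_g : inner ℂ (mulC B g) (mulC (fourier 1) x) =
      inner ℂ g (monomial 0) * inner ℂ (mulC B (monomial 0)) (mulC (fourier 1) x) := by
    conv_lhs => rw [g_eq]
    rw [map_add, inner_add_left, inner_shift, add_zero, map_smul, inner_smul_left,
      inner_conj_symm]
  rw [inner_sub_right, inner_smul_right, inner_mulC_mulC hB.2, inner_g, mul_comm, sub_self]

lemma offDiag_mulC_fourier_one (hB : B ∈ innerFunction) (x : modelSpace B) :
    offDiag (modelSpace B) (mulC (fourier 1)) x =
      inner ℂ (mulC (fourier (-1)) (mulC B (monomial 0))) (x : L2) • mulC B (monomial 0) := by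
  rw [inner_mulC_left, star_fourier, neg_neg]
  exact offDiag_eq_of_sub_mem (mulC_fourier_one_sub_mem_modelSpace hB x.2)
    (Submodule.smul_mem _ _ (mulC_mem_orthogonal_modelSpace (monomial_mem_hardy le_rfl)))

lemma mulC_fourier_neg_one_sub_mem_modelSpace (hB : B ∈ multiplier) {x : L2}
    (hx : x ∈ modelSpace B) :
    mulC (fourier (-1)) x - inner ℂ (monomial 0) x • monomial (-1) ∈ modelSpace B := by
  obtain ⟨hx_hardy, hx_orth⟩ := mem_modelSpace_iff.1 hx
  refine mem_modelSpace_iff.2 ⟨backwardShift_mem_hardy hx_hardy, fun g hg => ?_⟩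
  have inner_neg_one : inner ℂ (mulC B g) (monomial (-1)) = 0 :=
    monomial_mem_orthogonal_hardy (by norm_num) _ (hB g hg)
  rw [inner_sub_right, inner_smul_right, inner_neg_one, mul_zero, sub_zero, ← star_fourier,
    ← inner_mulC_left, mulC_left_comm]
  exact hx_orth _ (fourier_one_mem_multiplier _ hg)

lemma offDiag_mulC_fourier_neg_one (hB : B ∈ multiplier) (x : modelSpace B) :
    offDiag (modelSpace B) (mulC (fourier (-1))) x =
      inner ℂ (monomial 0) (x : L2) • monomial (-1) :=
  offDiag_eq_of_sub_mem (mulC_fourier_neg_one_sub_mem_modelSpace hB x.2) (Submodule.smul_mem _ _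
    (orthogonal_hardy_le (monomial_mem_orthogonal_hardy (by norm_num))))

variable {ι : Type*} [Fintype ι]

lemma hsNorm_offDiag_mulC_fourier_one_le (hB : B ∈ innerFunction)
    (v : OrthonormalBasis ι ℂ (modelSpace B)) :
    hsNorm v (offDiag (modelSpace B) (mulC (fourier 1))) ≤ 1 := by
  refine (hsNorm_offDiag_le_of_eq_inner_smul v (offDiag_mulC_fourier_one hB)).trans_eq ?_
  simp only [norm_mulC_apply (fourier_mem_unitary _), norm_mulC_apply hB.2, norm_monomial, mul_one]

lemma hsNorm_offDiag_mulC_fourier_neg_one_le (hB : B ∈ multiplier)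
    (v : OrthonormalBasis ι ℂ (modelSpace B)) :
    hsNorm v (offDiag (modelSpace B) (mulC (fourier (-1)))) ≤ 1 := by
  refine (hsNorm_offDiag_le_of_eq_inner_smul v (offDiag_mulC_fourier_neg_one hB)).trans_eq ?_
  simp only [norm_monomial, mul_one]

section AlmostInvariant

variable {α : Type*} {l : Filter α} {ι : α → Type*} [∀ a, Fintype (ι a)] {B : α → C(𝕋, ℂ)}

lemma mulC_fourier_mem_almostInvariant (hB : ∀ a, B a ∈ innerFunction)
    (v : ∀ a, OrthonormalBasis (ι a) ℂ (modelSpace (B a)))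
    (hcard : Tendsto (fun a => Fintype.card (ι a)) l atTop) (n : ℤ) :
    mulC (fourier n) ∈ almostInvariant l v := by
  have fourier_add' (i j : ℤ) : (fourier (i + j) : C(𝕋, ℂ)) = fourier i * fourier j := by
    ext t
    exact fourier_add
  induction n with
  | zero =>
    have fourier_zero' : (fourier 0 : C(𝕋, ℂ)) = 1 := by
      ext t
      exact fourier_zero
    rw [fourier_zero', mulC_one]
    exact one_mem _
  | succ n ih =>
    rw [fourier_add', mulC_mul]
    exact mul_mem ih (mem_almostInvariant_of_hsNorm_le hcard 1 fun a =>
      hsNorm_offDiag_mulC_fourier_one_le (hB a) (v a))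
  | pred n ih =>
    rw [sub_eq_add_neg, fourier_add', mulC_mul]
    exact mul_mem ih (mem_almostInvariant_of_hsNorm_le hcard 1 fun a =>
      hsNorm_offDiag_mulC_fourier_neg_one_le (hB a).1 (v a))

theorem mulC_mem_almostInvariant (hB : ∀ a, B a ∈ innerFunction)
    (v : ∀ a, OrthonormalBasis (ι a) ℂ (modelSpace (B a)))
    (hcard : Tendsto (fun a => Fintype.card (ι a)) l atTop) (F : C(𝕋, ℂ)) :
    mulC F ∈ almostInvariant l v := by
  set S : Submodule ℂ C(𝕋, ℂ) := (Subalgebra.toSubmodule (almostInvariant l v)).comap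
    (mulC : C(𝕋, ℂ) →ₗ[ℂ] (L2 →L[ℂ] L2))
  have span_le : Submodule.span ℂ (Set.range (fourier (T := 1))) ≤ S := by
    rw [Submodule.span_le]
    rintro _ ⟨n, rfl⟩
    exact mulC_fourier_mem_almostInvariant hB v hcard n
  have isClosed_S : IsClosed (S : Set C(𝕋, ℂ)) := isClosed_almostInvariant.preimage mulC.continuous
  exact Submodule.topologicalClosure_minimal _ span_le isClosed_S
    (span_fourier_closure_eq_top (T := 1) ▸ Submodule.mem_top)

end AlmostInvariant

end ModelSpace

section BlaschkeFactor

lemma norm_pt (t : 𝕋) : ‖pt t‖ = 1 := Circle.norm_coe _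

lemma pt_mul_conj (t : 𝕋) : pt t * conj (pt t) = 1 := by
  simp [Complex.mul_conj', norm_pt]

lemma fourier_one_apply (t : 𝕋) : fourier 1 t = pt t := fourier_one

lemma fourier_neg_one_apply (t : 𝕋) : fourier (-1) t = conj (pt t) := by
  rw [fourier_neg, fourier_one_apply]

lemma norm_one_sub_conj_mul_pt (l : ℂ) (t : 𝕋) : ‖1 - conj l * pt t‖ = ‖pt t - l‖ := by
  have h : 1 - conj l * pt t = pt t * conj (pt t - l) := by
    rw [map_sub, mul_sub, pt_mul_conj, mul_comm (conj l)]
  rw [h, norm_mul, norm_pt, one_mul, RCLike.norm_conj]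

lemma one_sub_norm_sq_pos {l : ℂ} (hl : ‖l‖ < 1) : 0 < 1 - ‖l‖ ^ 2 :=
  sub_pos.2 (pow_lt_one₀ (norm_nonneg l) hl two_ne_zero)

/-- The reciprocal `1 - conj l ζ` of the Cauchy kernel at `l`. -/
def cauchyDenom (l : ℂ) : C(𝕋, ℂ) := 1 - conj l • fourier 1

lemma cauchyDenom_apply (l : ℂ) (t : 𝕋) : cauchyDenom l t = 1 - conj l * pt t := by
  simp [cauchyDenom, pt]

lemma cauchyDenom_mem_multiplier (l : ℂ) : cauchyDenom l ∈ multiplier :=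
  sub_mem (one_mem _) (multiplier.smul_mem fourier_one_mem_multiplier _)

/-- The Cauchy kernel `(1 - conj l ζ)⁻¹` at `l`, as a continuous function on the circle; it is `0`
by convention if `l` lies on the circle. -/
def cauchyKernel (l : ℂ) : C(𝕋, ℂ) := Ring.inverse (cauchyDenom l)

lemma norm_conj_smul_fourier_one_lt_one {l : ℂ} (hl : ‖l‖ < 1) :
    ‖conj l • (fourier 1 : C(𝕋, ℂ))‖ < 1 := by
  rwa [norm_smul, fourier_norm, mul_one, RCLike.norm_conj]

lemma cauchyDenom_mul_cauchyKernel {l : ℂ} (hl : ‖l‖ < 1) :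
    cauchyDenom l * cauchyKernel l = 1 :=
  Ring.mul_inverse_cancel _ (isUnit_one_sub_of_norm_lt_one (norm_conj_smul_fourier_one_lt_one hl))

lemma mulC_cauchyDenom_mulC_cauchyKernel {l : ℂ} (hl : ‖l‖ < 1) (u : L2) :
    mulC (cauchyDenom l) (mulC (cauchyKernel l) u) = u := by
  rw [← mulC_mul_apply, cauchyDenom_mul_cauchyKernel hl, mulC_one, one_apply_eq_self]

lemma cauchyKernel_apply {l : ℂ} (hl : ‖l‖ < 1) (t : 𝕋) :
    cauchyKernel l t = (1 - conj l * pt t)⁻¹ := by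
  rw [← cauchyDenom_apply]
  exact eq_inv_of_mul_eq_one_right (congrArg (· t) (cauchyDenom_mul_cauchyKernel hl))

lemma cauchyKernel_mem_multiplier {l : ℂ} (hl : ‖l‖ < 1) : cauchyKernel l ∈ multiplier := by
  have norm_lt := norm_conj_smul_fourier_one_lt_one hl
  have neumann : HasSum (fun n : ℕ => (conj l • (fourier 1 : C(𝕋, ℂ))) ^ n) (cauchyKernel l) := by
    rw [cauchyKernel, cauchyDenom, NormedRing.inverse_one_sub _ norm_lt]
    exact (summable_geometric_of_norm_lt_one norm_lt).hasSum
  exact isClosed_multiplier.mem_of_tendsto neumann (.of_forall fun s =>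
    sum_mem fun n _ => pow_mem (multiplier.smul_mem fourier_one_mem_multiplier _) n)

/-- The unimodular constant in the Blaschke factor with zero `l`. -/
def blaschkeConst (l : ℂ) : ℂ := if l = 0 then 1 else conj l / (‖l‖ : ℂ)

lemma norm_blaschkeConst (l : ℂ) : ‖blaschkeConst l‖ = 1 := by
  unfold blaschkeConst
  split_ifs with hl
  · exact norm_one
  · rw [norm_div, RCLike.norm_conj, Complex.norm_real, norm_norm, div_self (norm_ne_zero_iff.2 hl)]

/-- The Blaschke factor with zero `l`, as a continuous function on the circle. -/
def blaschkeFactor (l : ℂ) : C(𝕋, ℂ) :=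
  blaschkeConst l • ((fourier 1 - l • 1) * cauchyKernel l)

lemma blaschkeFactor_apply {l : ℂ} (hl : ‖l‖ < 1) (t : 𝕋) :
    blaschkeFactor l t = blaschkeConst l * ((pt t - l) / (1 - conj l * pt t)) := by
  simp only [blaschkeFactor, ContinuousMap.smul_apply, ContinuousMap.mul_apply,
    ContinuousMap.sub_apply, ContinuousMap.one_apply, cauchyKernel_apply hl,
    fourier_one_apply, smul_eq_mul, mul_one, div_eq_mul_inv]

lemma norm_blaschkeFactor_apply {l : ℂ} (hl : ‖l‖ < 1) (t : 𝕋) : ‖blaschkeFactor l t‖ = 1 := by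
  have sub_ne_zero : ‖pt t - l‖ ≠ 0 :=
    norm_ne_zero_iff.2 (sub_ne_zero.2 fun h => hl.ne (h ▸ norm_pt t))
  rw [blaschkeFactor_apply hl, norm_mul, norm_blaschkeConst, norm_div, norm_one_sub_conj_mul_pt,
    div_self sub_ne_zero, one_mul]

lemma blaschkeFactor_mem_innerFunction {l : ℂ} (hl : ‖l‖ < 1) :
    blaschkeFactor l ∈ innerFunction := by
  refine ⟨multiplier.smul_mem (mul_mem (sub_mem fourier_one_mem_multiplier
    (multiplier.smul_mem (one_mem _) l)) (cauchyKernel_mem_multiplier hl)) _, ?_⟩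
  rw [SetLike.mem_coe, Unitary.mem_iff_star_mul_self]
  ext t
  simp [Complex.conj_mul', norm_blaschkeFactor_apply hl]

lemma star_blaschkeFactor_mul_cauchyDenom {l : ℂ} (hl : ‖l‖ < 1) :
    star (blaschkeFactor l * cauchyDenom l) =
      conj (blaschkeConst l) • (fourier (-1) * cauchyDenom l) := by
  rw [blaschkeFactor, smul_mul_assoc, mul_assoc, mul_comm (cauchyKernel l),
    cauchyDenom_mul_cauchyKernel hl, mul_one]
  ext t
  simp only [ContinuousMap.star_apply, ContinuousMap.smul_apply, ContinuousMap.sub_apply,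
    ContinuousMap.mul_apply, ContinuousMap.one_apply, fourier_one_apply, fourier_neg_one_apply,
    cauchyDenom_apply, RCLike.star_def, smul_eq_mul, map_mul, map_sub, mul_one]
  linear_combination (conj (blaschkeConst l) * conj l) * pt_mul_conj t

lemma modelSpace_fourier_one :
    modelSpace (fourier 1 : C(𝕋, ℂ)) = Submodule.span ℂ {monomial 0} := by
  refine le_antisymm (fun u hu => ?_) ?_
  · obtain ⟨hu_hardy, hu_orth⟩ := mem_modelSpace_iff.1 hu
    refine Submodule.mem_span_singleton.2
      ⟨inner ℂ (monomial 0) u, ext_of_inner_monomial fun n => ?_⟩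
    rw [inner_smul_right, inner_monomial]
    rcases lt_trichotomy n 0 with hn | rfl | hn
    · rw [if_neg hn.ne, mul_zero, inner_monomial_of_mem_hardy hu_hardy hn]
    · rw [if_pos rfl, mul_one]
    · have h := hu_orth _ (monomial_mem_hardy (n := n - 1) (by omega))
      rw [mulC_fourier_monomial, sub_add_cancel] at h
      rw [if_neg hn.ne', mul_zero, h]
  · rw [Submodule.span_singleton_le_iff_mem, mem_modelSpace_iff]
    refine ⟨monomial_mem_hardy le_rfl, fun g hg => ?_⟩
    rw [inner_eq_zero_symm, inner_monomial_mulC_fourier]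
    exact inner_monomial_of_mem_hardy hg (by norm_num)

/-- With `F = 1 - conj l ζ` and `f = F g`, the condition `b f ⟂ h` becomes `ζ g ⟂ F h`, because
`conj (b F)` is a multiple of `conj ζ F`. -/
lemma mem_modelSpace_blaschkeFactor_iff {l : ℂ} (hl : ‖l‖ < 1) {h : L2} :
    h ∈ modelSpace (blaschkeFactor l) ↔
      mulC (cauchyDenom l) h ∈ modelSpace (fourier 1 : C(𝕋, ℂ)) := by
  have inner_eq (g : L2) : inner ℂ (mulC (blaschkeFactor l) (mulC (cauchyDenom l) g)) h =
      conj (blaschkeConst l) * inner ℂ (mulC (fourier 1) g) (mulC (cauchyDenom l) h) := by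
    rw [← mulC_mul_apply, inner_mulC_left, star_blaschkeFactor_mul_cauchyDenom hl, map_smul,
      smul_apply, inner_smul_right, mulC_mul_apply, inner_mulC_left _ g, star_fourier]
  have const_ne_zero : conj (blaschkeConst l) ≠ 0 :=
    norm_ne_zero_iff.1 (by simp [norm_blaschkeConst])
  have kernel_denom (u : L2) : mulC (cauchyKernel l) (mulC (cauchyDenom l) u) = u := by
    rw [mulC_left_comm, mulC_cauchyDenom_mulC_cauchyKernel hl]
  simp only [mem_modelSpace_iff]
  refine and_congr ⟨cauchyDenom_mem_multiplier l h, fun hh => ?_⟩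
    ⟨fun hh g hg => ?_, fun hh g hg => ?_⟩
  · exact kernel_denom h ▸ cauchyKernel_mem_multiplier hl _ hh
  · have h_zero := hh _ (cauchyDenom_mem_multiplier l g hg)
    rw [inner_eq] at h_zero
    exact (mul_eq_zero.1 h_zero).resolve_left const_ne_zero
  · rw [← mulC_cauchyDenom_mulC_cauchyKernel hl g, inner_eq,
      hh _ (cauchyKernel_mem_multiplier hl g hg), mul_zero]

/-- The Cauchy kernel at `l` as an element of `L²(𝕋)`. -/
def cauchyVec (l : ℂ) : L2 := mulC (cauchyKernel l) (monomial 0)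

lemma modelSpace_blaschkeFactor {l : ℂ} (hl : ‖l‖ < 1) :
    modelSpace (blaschkeFactor l) = Submodule.span ℂ {cauchyVec l} := by
  ext h
  rw [mem_modelSpace_blaschkeFactor_iff hl, modelSpace_fourier_one, Submodule.mem_span_singleton,
    Submodule.mem_span_singleton]
  refine exists_congr fun c => ⟨fun hc => ?_, fun hc => ?_⟩
  · rw [cauchyVec, ← map_smul, hc, mulC_left_comm, mulC_cauchyDenom_mulC_cauchyKernel hl]
  · rw [← hc, cauchyVec, map_smul, mulC_cauchyDenom_mulC_cauchyKernel hl]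

lemma cauchyVec_mem_hardy {l : ℂ} (hl : ‖l‖ < 1) : cauchyVec l ∈ hardy :=
  cauchyKernel_mem_multiplier hl _ (monomial_mem_hardy le_rfl)

/-- Pythagoras for `k = 1 + conj l ζ k`. -/
lemma one_sub_norm_sq_mul_norm_cauchyVec_sq {l : ℂ} (hl : ‖l‖ < 1) :
    (1 - ‖l‖ ^ 2) * ‖cauchyVec l‖ ^ 2 = 1 := by
  have recurrence : cauchyVec l = monomial 0 + conj l • mulC (fourier 1) (cauchyVec l) := by
    have h := mulC_cauchyDenom_mulC_cauchyKernel hl (monomial 0)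
    rw [← cauchyVec, cauchyDenom, map_sub, map_smul, mulC_one, sub_apply, smul_apply,
      one_apply_eq_self] at h
    exact sub_eq_iff_eq_add.1 h
  have orthogonal : inner ℂ (monomial 0) (conj l • mulC (fourier 1) (cauchyVec l)) = 0 := by
    rw [inner_smul_right, inner_monomial_mulC_fourier,
      inner_monomial_of_mem_hardy (cauchyVec_mem_hardy hl) (by norm_num), mul_zero]
  have pythagoras := norm_add_sq_eq_norm_sq_add_norm_sq_of_inner_eq_zero _ _ orthogonal
  rw [← recurrence, norm_smul, norm_mulC_apply (fourier_mem_unitary 1), norm_monomial,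
    RCLike.norm_conj] at pythagoras
  linear_combination pythagoras

end BlaschkeFactor

section TakenakaMalmquist

variable {Λ : ℕ → ℂ}

lemma coe_prod_blaschkeFactor (hΛ : ∀ j, ‖Λ j‖ < 1) (N : ℕ) :
    ⇑(∏ j ∈ Finset.range N, blaschkeFactor (Λ j)) = fun t => blaschke Λ N (pt t) := by
  ext t
  rw [ContinuousMap.prod_apply, blaschke]
  exact Finset.prod_congr rfl fun j _ => blaschkeFactor_apply (hΛ j) t

variable (hΛ : ∀ j, ‖Λ j‖ < 1)

/-- The Blaschke product `B_N` as a continuous function on the circle. It is not defined as a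
product, so that `modelSpace (blaschkeMap hΛ N)` is definitionally the domain of `toeplitzN Λ N`. -/
def blaschkeMap (N : ℕ) : C(𝕋, ℂ) where
  toFun t := blaschke Λ N (pt t)
  continuous_toFun := coe_prod_blaschkeFactor hΛ N ▸ map_continuous _

lemma blaschkeMap_eq_prod (N : ℕ) :
    blaschkeMap hΛ N = ∏ j ∈ Finset.range N, blaschkeFactor (Λ j) :=
  DFunLike.coe_injective (coe_prod_blaschkeFactor hΛ N).symm

lemma blaschkeMap_zero : blaschkeMap hΛ 0 = 1 := by
  rw [blaschkeMap_eq_prod, Finset.prod_range_zero]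

lemma blaschkeMap_succ (N : ℕ) :
    blaschkeMap hΛ (N + 1) = blaschkeMap hΛ N * blaschkeFactor (Λ N) := by
  rw [blaschkeMap_eq_prod, blaschkeMap_eq_prod, Finset.prod_range_succ]

lemma blaschkeMap_mem_innerFunction (N : ℕ) : blaschkeMap hΛ N ∈ innerFunction := by
  rw [blaschkeMap_eq_prod]
  exact prod_mem fun j _ => blaschkeFactor_mem_innerFunction (hΛ j)

lemma norm_blaschkeMap_apply (N : ℕ) (t : 𝕋) : ‖blaschkeMap hΛ N t‖ = 1 := by
  rw [blaschkeMap_eq_prod, ContinuousMap.prod_apply, norm_prod]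
  exact Finset.prod_eq_one fun j _ => norm_blaschkeFactor_apply (hΛ j) t

/-- The Takenaka–Malmquist functions `√(1 - |λ_k|²) B_k / (1 - conj λ_k ζ)`, which form an
orthonormal basis of `K_{B_N}` for `k < N`. -/
def takenakaMalmquist (k : ℕ) : L2 :=
  (√(1 - ‖Λ k‖ ^ 2) : ℂ) • mulC (blaschkeMap hΛ k) (cauchyVec (Λ k))

lemma norm_takenakaMalmquist (k : ℕ) : ‖takenakaMalmquist hΛ k‖ = 1 := by
  rw [← sq_eq_sq₀ (norm_nonneg _) zero_le_one, takenakaMalmquist, norm_smul, mul_pow,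
    Complex.norm_real, Real.norm_eq_abs, sq_abs, Real.sq_sqrt (one_sub_norm_sq_pos (hΛ k)).le,
    norm_mulC_apply (blaschkeMap_mem_innerFunction hΛ k).2,
    one_sub_norm_sq_mul_norm_cauchyVec_sq (hΛ k), one_pow]

lemma modelSpace_blaschkeMap (N : ℕ) :
    modelSpace (blaschkeMap hΛ N) =
      Submodule.span ℂ (Set.range fun k : Fin N => takenakaMalmquist hΛ k) := by
  rw [Set.range_comp' (takenakaMalmquist hΛ), Fin.range_val]
  induction N with
  | zero =>
    rw [blaschkeMap_zero, modelSpace_one]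
    simp
  | succ N ih =>
    have sqrt_ne_zero : (√(1 - ‖Λ N‖ ^ 2) : ℂ) ≠ 0 :=
      Complex.ofReal_ne_zero.2 (Real.sqrt_pos.2 (one_sub_norm_sq_pos (hΛ N))).ne'
    rw [blaschkeMap_succ, modelSpace_mul (blaschkeMap_mem_innerFunction hΛ N)
      (blaschkeFactor_mem_innerFunction (hΛ N)).1, ih, modelSpace_blaschkeFactor (hΛ N),
      Submodule.map_span, Set.image_singleton,
      ← Submodule.span_singleton_smul_eq sqrt_ne_zero.isUnit, ← Submodule.span_union,
      Set.union_singleton, ← Order.succ_eq_add_one, Order.Iio_succ_eq_insert, Set.image_insert_eq]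
    rfl

lemma takenakaMalmquist_mem_modelSpace {k N : ℕ} (hk : k < N) :
    takenakaMalmquist hΛ k ∈ modelSpace (blaschkeMap hΛ N) :=
  modelSpace_blaschkeMap hΛ N ▸ Submodule.subset_span ⟨⟨k, hk⟩, rfl⟩

lemma takenakaMalmquist_mem_orthogonal (k : ℕ) :
    takenakaMalmquist hΛ k ∈ (modelSpace (blaschkeMap hΛ k))ᗮ :=
  Submodule.smul_mem _ _ (mulC_mem_orthogonal_modelSpace (cauchyVec_mem_hardy (hΛ k)))

lemma orthonormal_takenakaMalmquist : Orthonormal ℂ (takenakaMalmquist hΛ) := by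
  refine ⟨norm_takenakaMalmquist hΛ, fun j k hjk => ?_⟩
  rcases lt_or_gt_of_ne hjk with h | h
  · exact takenakaMalmquist_mem_orthogonal hΛ k _ (takenakaMalmquist_mem_modelSpace hΛ h)
  · exact inner_eq_zero_symm.1
      (takenakaMalmquist_mem_orthogonal hΛ j _ (takenakaMalmquist_mem_modelSpace hΛ h))

/-- The Takenaka–Malmquist basis of the model space `K_{B_N}`. -/
def modelBasis (N : ℕ) : OrthonormalBasis (Fin N) ℂ (modelSpace (blaschkeMap hΛ N)) :=
  OrthonormalBasis.mk
    (v := fun k : Fin N => ⟨takenakaMalmquist hΛ k, takenakaMalmquist_mem_modelSpace hΛ k.2⟩)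
    (((orthonormal_takenakaMalmquist hΛ).comp _ Fin.val_injective).codRestrict _ _)
    (by
      rw [← Submodule.map_le_map_iff_of_injective (Submodule.subtype_injective _),
        Submodule.map_subtype_top, Submodule.map_span, ← Set.range_comp]
      exact (modelSpace_blaschkeMap hΛ N).le)

@[simp]
lemma coe_modelBasis (N : ℕ) (k : Fin N) : (modelBasis hΛ N k : L2) = takenakaMalmquist hΛ k :=
  congrArg Subtype.val (congrFun (OrthonormalBasis.coe_mk _ _) k)

end TakenakaMalmquist

section KernelMeasure

variable {ι : Type*} [Fintype ι] (e : ι → L2)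

/-- The measure `∑ᵢ |eᵢ|² dm`. For an orthonormal basis `e` of a subspace its density is the
reproducing kernel of the subspace on the diagonal. -/
def kernelMeasure : Measure 𝕋 := m.withDensity fun t => ∑ i, ‖e i t‖ₑ ^ 2

lemma aemeasurable_sum_enorm_sq : AEMeasurable (fun t => ∑ i, ‖e i t‖ₑ ^ 2) m :=
  Finset.aemeasurable_fun_sum _ fun i _ => (Lp.aestronglyMeasurable (e i)).enorm.pow_const 2

lemma eLpNorm_two_sq_eq_lintegral {α : Type*} [MeasurableSpace α] (μ : Measure α) (f : α → ℂ) :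
    eLpNorm f 2 μ ^ 2 = ∫⁻ t, ‖f t‖ₑ ^ 2 ∂μ := by
  simpa using eLpNorm_nnreal_pow_eq_lintegral (f := f) (μ := μ) (p := 2) two_ne_zero

variable {A : L2 →L[ℂ] L2} {ψ : 𝕋 → ℂ}

lemma sum_inner_eq_integral_kernelMeasure (hA : ∀ u : L2, A u =ᵐ[m] fun t => ψ t * u t) :
    ∑ i, inner ℂ (e i) (A (e i)) = ∫ t, ψ t ∂(kernelMeasure e) := by
  calc ∑ i, inner ℂ (e i) (A (e i))
      = ∫ t, ∑ i, inner ℂ (e i t) (A (e i) t) ∂m :=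
        (integral_finsetSum _ fun i _ => L2.integrable_inner _ _).symm
    _ = ∫ t, (∑ i, ‖e i t‖ₑ ^ 2).toReal • ψ t ∂m := by
        refine integral_congr_ae ?_
        filter_upwards [ae_all_iff.2 fun i => hA (e i)] with t ht
        rw [ENNReal.toReal_sum fun i _ => by finiteness, Finset.sum_smul]
        refine Finset.sum_congr rfl fun i _ => ?_
        rw [ht i, RCLike.inner_apply, mul_assoc, Complex.mul_conj', mul_comm, ENNReal.toReal_pow,
          toReal_enorm, Complex.real_smul, Complex.ofReal_pow]
    _ = ∫ t, ψ t ∂(kernelMeasure e) :=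
        (integral_withDensity_eq_integral_toReal_smul₀ (aemeasurable_sum_enorm_sq e)
          (.of_forall fun t => ENNReal.sum_lt_top.2 fun i _ => by finiteness) ψ).symm

lemma sum_enorm_sq_eq_lintegral_kernelMeasure (hψ : AEMeasurable ψ m)
    (hA : ∀ u : L2, A u =ᵐ[m] fun t => ψ t * u t) :
    ∑ i, ‖A (e i)‖ₑ ^ 2 = ∫⁻ t, ‖ψ t‖ₑ ^ 2 ∂(kernelMeasure e) := by
  calc ∑ i, ‖A (e i)‖ₑ ^ 2 = ∑ i, ∫⁻ t, ‖A (e i) t‖ₑ ^ 2 ∂m := by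
        simp only [Lp.enorm_def, eLpNorm_two_sq_eq_lintegral]
    _ = ∫⁻ t, ∑ i, ‖A (e i) t‖ₑ ^ 2 ∂m :=
        (lintegral_finsetSum' _ fun i _ =>
          (Lp.aestronglyMeasurable (A (e i))).enorm.pow_const 2).symm
    _ = ∫⁻ t, (∑ i, ‖e i t‖ₑ ^ 2) * ‖ψ t‖ₑ ^ 2 ∂m := by
        refine lintegral_congr_ae ?_
        filter_upwards [ae_all_iff.2 fun i => hA (e i)] with t ht
        rw [Finset.sum_mul]
        exact Finset.sum_congr rfl fun i _ => by rw [ht i, enorm_mul, mul_pow, mul_comm]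
    _ = ∫⁻ t, ‖ψ t‖ₑ ^ 2 ∂(kernelMeasure e) :=
        (lintegral_withDensity_eq_lintegral_mul₀ (aemeasurable_sum_enorm_sq e)
          (hψ.enorm.pow_const 2)).symm

lemma kernelMeasure_univ : kernelMeasure e Set.univ = ∑ i, ‖e i‖ₑ ^ 2 := by
  have h := sum_enorm_sq_eq_lintegral_kernelMeasure e (A := 1) (ψ := 1) aemeasurable_one
    fun u => .of_forall fun t => (one_mul _).symm
  simpa using h.symm

end KernelMeasure

section MeanHarmonicMeasure

variable {Λ : ℕ → ℂ}

lemma continuous_pt : Continuous pt := continuous_subtype_val.comp AddCircle.continuous_toCircle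

lemma nu_absolutelyContinuous (Λ : ℕ → ℂ) (N : ℕ) : nu Λ N ≪ m :=
  withDensity_absolutelyContinuous _ _

lemma enorm_sq_takenakaMalmquist_apply (hΛ : ∀ j, ‖Λ j‖ < 1) (k : ℕ) :
    ∀ᵐ t ∂m, ‖takenakaMalmquist hΛ k t‖ₑ ^ 2 =
      ENNReal.ofReal ((1 - ‖Λ k‖ ^ 2) / ‖pt t - Λ k‖ ^ 2) := by
  filter_upwards [Lp.coeFn_smul (√(1 - ‖Λ k‖ ^ 2) : ℂ) (mulC (blaschkeMap hΛ k) (cauchyVec (Λ k))),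
    coeFn_mulC (blaschkeMap hΛ k) (cauchyVec (Λ k)),
    coeFn_mulC (cauchyKernel (Λ k)) (monomial 0), coeFn_monomial 0]
    with t h_smul h_blaschke h_cauchy h_monomial
  have norm_eq : ‖takenakaMalmquist hΛ k t‖ = √(1 - ‖Λ k‖ ^ 2) / ‖pt t - Λ k‖ := by
    rw [takenakaMalmquist, h_smul, Pi.smul_apply, h_blaschke, cauchyVec, h_cauchy, h_monomial,
      fourier_zero, mul_one, norm_smul, norm_mul, norm_blaschkeMap_apply, one_mul,
      cauchyKernel_apply (hΛ k), norm_inv, norm_one_sub_conj_mul_pt, Complex.norm_real,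
      Real.norm_of_nonneg (Real.sqrt_nonneg _), div_eq_mul_inv]
  rw [← ofReal_norm, ← ENNReal.ofReal_pow (norm_nonneg _), norm_eq, div_pow,
    Real.sq_sqrt (one_sub_norm_sq_pos (hΛ k)).le]

theorem kernelMeasure_modelBasis (hΛ : ∀ j, ‖Λ j‖ < 1) (N : ℕ) :
    kernelMeasure (fun i => (modelBasis hΛ N i : L2)) = (N : ℝ≥0∞) • nu Λ N := by
  have measurable_density : Measurable fun t => ENNReal.ofReal
      ((1 / (N : ℝ)) * ∑ j ∈ Finset.range N, (1 - ‖Λ j‖ ^ 2) / ‖pt t - Λ j‖ ^ 2) := by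
    have := continuous_pt.measurable
    fun_prop
  rw [kernelMeasure, nu, ← withDensity_smul _ measurable_density]
  refine withDensity_congr_ae ?_
  filter_upwards [ae_all_iff.2 (enorm_sq_takenakaMalmquist_apply hΛ)] with t ht
  rcases eq_or_ne N 0 with rfl | hN
  · simp
  simp only [coe_modelBasis, ht, Pi.smul_apply, smul_eq_mul]
  rw [← Finset.sum_range fun k => ENNReal.ofReal ((1 - ‖Λ k‖ ^ 2) / ‖pt t - Λ k‖ ^ 2),
    ← ENNReal.ofReal_sum_of_nonneg fun k _ =>
      div_nonneg (one_sub_norm_sq_pos (hΛ k)).le (by positivity),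
    ← ENNReal.ofReal_natCast, ← ENNReal.ofReal_mul (by positivity)]
  field_simp

lemma isProbabilityMeasure_nu (hΛ : ∀ j, ‖Λ j‖ < 1) {N : ℕ} (hN : N ≠ 0) :
    IsProbabilityMeasure (nu Λ N) := by
  have enorm_modelBasis (i : Fin N) : ‖(modelBasis hΛ N i : L2)‖ₑ = 1 := by
    rw [← ofReal_norm, ← Submodule.coe_norm, (modelBasis hΛ N).norm_eq_one, ENNReal.ofReal_one]
  have mass_eq := kernelMeasure_univ fun i => (modelBasis hΛ N i : L2)
  rw [kernelMeasure_modelBasis, Measure.smul_apply, smul_eq_mul] at mass_eq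
  simp only [enorm_modelBasis, one_pow, Finset.sum_const, Finset.card_univ, Fintype.card_fin,
    nsmul_one] at mass_eq
  exact ⟨(ENNReal.mul_eq_left (by simpa using hN) (by simp)).1 mass_eq⟩

lemma isFiniteMeasure_nu (hΛ : ∀ j, ‖Λ j‖ < 1) (N : ℕ) : IsFiniteMeasure (nu Λ N) := by
  rcases eq_or_ne N 0 with rfl | hN
  · have nu_zero : nu Λ 0 = 0 := by simp [nu]
    rw [nu_zero]
    infer_instance
  · have := isProbabilityMeasure_nu hΛ hN
    infer_instance

lemma tr_compress_modelSpace (hΛ : ∀ j, ‖Λ j‖ < 1) (N : ℕ) {A : L2 →L[ℂ] L2} {ψ : 𝕋 → ℂ}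
    (hA : ∀ u : L2, A u =ᵐ[m] fun t => ψ t * u t) :
    tr (compress (modelSpace (blaschkeMap hΛ N)) A) = N * ∫ t, ψ t ∂(nu Λ N) := by
  calc tr (compress (modelSpace (blaschkeMap hΛ N)) A)
      = ∑ i, inner ℂ (modelBasis hΛ N i : L2) (A (modelBasis hΛ N i)) := by
        rw [tr, LinearMap.trace_eq_sum_inner _ (modelBasis hΛ N)]
        exact Finset.sum_congr rfl fun i _ => inner_compress_right _ A _ _
    _ = N * ∫ t, ψ t ∂(nu Λ N) := by
        rw [sum_inner_eq_integral_kernelMeasure _ hA, kernelMeasure_modelBasis,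
          integral_smul_measure, ENNReal.toReal_natCast, Complex.real_smul, Complex.ofReal_natCast]

lemma hsNorm_comp_subtypeL_le (hΛ : ∀ j, ‖Λ j‖ < 1) (N : ℕ) {A : L2 →L[ℂ] L2} {ψ : 𝕋 → ℂ} {ε : ℝ}
    (hψ : AEMeasurable ψ m) (hA : ∀ u : L2, A u =ᵐ[m] fun t => ψ t * u t) (hε : 0 ≤ ε)
    (hψε : eLpNorm ψ 2 (nu Λ N) ≤ ENNReal.ofReal ε) :
    hsNorm (modelBasis hΛ N) (A ∘L (modelSpace (blaschkeMap hΛ N)).subtypeL) ≤ ε * √N := by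
  refine le_of_sq_le_sq ?_ (by positivity)
  rw [← ENNReal.ofReal_le_ofReal_iff (by positivity), mul_pow, Real.sq_sqrt (by positivity)]
  calc ENNReal.ofReal (hsNorm (modelBasis hΛ N) (A ∘L Submodule.subtypeL _) ^ 2)
      = ∑ i, ‖A (modelBasis hΛ N i)‖ₑ ^ 2 := by
        rw [hsNorm_sq, ENNReal.ofReal_sum_of_nonneg fun i _ => by positivity]
        refine Finset.sum_congr rfl fun i _ => ?_
        rw [ENNReal.ofReal_pow (norm_nonneg _), ofReal_norm]
        rfl
    _ = N * eLpNorm ψ 2 (nu Λ N) ^ 2 := by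
        rw [sum_enorm_sq_eq_lintegral_kernelMeasure (fun i => (modelBasis hΛ N i : L2)) hψ hA,
          kernelMeasure_modelBasis, lintegral_smul_measure, eLpNorm_two_sq_eq_lintegral,
          smul_eq_mul]
    _ ≤ N * ENNReal.ofReal ε ^ 2 := by gcongr
    _ = ENNReal.ofReal (ε ^ 2 * N) := by
        rw [ENNReal.ofReal_mul (by positivity), ENNReal.ofReal_natCast, ENNReal.ofReal_pow hε,
          mul_comm]

theorem mulOp_mem_almostInvariant (hΛ : ∀ j, ‖Λ j‖ < 1) {φ : Linf}
    (hφ : (φ : 𝕋 → ℂ) ∈ spaceX Λ) : mulOp φ ∈ almostInvariant atTop (modelBasis hΛ) := by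
  refine mem_almostInvariant_of_approx fun ε hε => ?_
  obtain ⟨g, hg⟩ := hφ.2 (ENNReal.ofReal ε) (ENNReal.ofReal_pos.2 hε)
  refine ⟨mulC g, mulC_mem_almostInvariant (blaschkeMap_mem_innerFunction hΛ) _
    (tendsto_id.congr fun N => (Fintype.card_fin N).symm) g, ?_⟩
  filter_upwards [eventually_ge_atTop 1] with N hN
  rw [Fintype.card_fin]
  refine hsNorm_comp_subtypeL_le hΛ N (ψ := fun t => φ t - g t) ?_ (fun u => ?_) hε.le ?_
  · exact (Lp.aestronglyMeasurable φ).aemeasurable.sub g.continuous.aemeasurable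
  · filter_upwards [Lp.coeFn_sub (mulOp φ u) (mulC g u), coeFn_mulOp φ u, coeFn_mulC g u]
      with t h_sub h_φ h_g
    rw [sub_apply, h_sub, Pi.sub_apply, h_φ, h_g, sub_mul]
  · exact (le_iSup₂ (f := fun N (_ : 1 ≤ N) => eLpNorm (fun t => φ t - g t) 2 (nu Λ N)) N hN).trans
      hg.le

lemma coeFn_aeval_mulOp (φ : Linf) (p : Polynomial ℂ) (u : L2) :
    Polynomial.aeval (mulOp φ) p u =ᵐ[m] fun t => p.eval (φ t) * u t := by
  induction p using Polynomial.induction_on generalizing u with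
  | C a =>
    rw [Polynomial.aeval_C, Algebra.algebraMap_eq_smul_one]
    filter_upwards [Lp.coeFn_smul a u] with t ht
    simpa using ht
  | add p q hp hq =>
    rw [map_add]
    filter_upwards [Lp.coeFn_add (Polynomial.aeval (mulOp φ) p u) (Polynomial.aeval (mulOp φ) q u),
      hp u, hq u] with t h_add h_p h_q
    rw [add_apply, h_add, Pi.add_apply, h_p, h_q, Polynomial.eval_add, add_mul]
  | monomial n a ih =>
    have pow_succ_eq : (.C a * .X ^ (n + 1) : Polynomial ℂ) = (.C a * .X ^ n) * .X := by ring
    rw [pow_succ_eq, map_mul (Polynomial.aeval _) _ Polynomial.X, Polynomial.aeval_X]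
    filter_upwards [ih (mulOp φ u), coeFn_mulOp φ u] with t h_ih h_mul
    rw [mul_apply_eq_comp, h_ih, h_mul, Polynomial.eval_mul_X, mul_assoc]

theorem tendsto_tr_aeval_toeplitzN (hΛ : ∀ j, ‖Λ j‖ < 1) {φ : Linf}
    (hφ : (φ : 𝕋 → ℂ) ∈ spaceX Λ) (p : Polynomial ℂ) :
    Tendsto (fun N : ℕ => ‖(1 / (N : ℂ)) * tr (Polynomial.aeval (toeplitzN Λ N φ) p) -
      ∫ t, p.eval (φ t) ∂(nu Λ N)‖) atTop (𝓝 0) := by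
  refine (isLittleO_trace_aeval_compress_sub (mulOp_mem_almostInvariant hΛ hφ)
    p).norm_left.tendsto_div_nhds_zero.congr' ?_
  filter_upwards [eventually_ne_atTop 0] with N hN
  have trace_sub : tr (compress (modelSpace (blaschkeMap hΛ N)) (Polynomial.aeval (mulOp φ) p) -
      Polynomial.aeval (truncToeplitz (blaschkeMap hΛ N) φ) p) =
        N * ∫ t, p.eval (φ t) ∂(nu Λ N) -
          tr (Polynomial.aeval (truncToeplitz (blaschkeMap hΛ N) φ) p) := by
    rw [← tr_compress_modelSpace hΛ N (coeFn_aeval_mulOp φ p)]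
    exact map_sub (LinearMap.trace ℂ _) _ _
  have normalize : (1 / (N : ℂ)) * tr (Polynomial.aeval (truncToeplitz (blaschkeMap hΛ N) φ) p) -
      ∫ t, p.eval (φ t) ∂(nu Λ N) = -(tr (compress (modelSpace (blaschkeMap hΛ N))
        (Polynomial.aeval (mulOp φ) p) -
          Polynomial.aeval (truncToeplitz (blaschkeMap hΛ N) φ) p) / N) := by
    rw [trace_sub]
    field_simp
    ring
  refine Eq.trans ?_ (congrArg norm normalize).symm
  rw [norm_neg, norm_div, Complex.norm_natCast, Fintype.card_fin]
  rfl

end MeanHarmonicMeasure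

section EssentialRange

lemma ae_norm_le (φ : Linf) : ∀ᵐ t ∂m, ‖φ t‖ ≤ ‖φ‖ := by
  filter_upwards [ae_le_eLpNormEssSup (f := φ) (μ := m)] with t ht
  rw [← eLpNorm_exponent_top, ← Lp.enorm_def] at ht
  exact enorm_le_iff_norm_le.1 ht

lemma ae_mem_essRange (φ : Linf) : ∀ᵐ t ∂m, φ t ∈ essRange φ := by
  have hφ : AEMeasurable φ m := (Lp.aestronglyMeasurable φ).aemeasurable
  filter_upwards [ae_of_ae_map hφ (Measure.support_mem_ae (μ := m.map φ))] with t ht ε hε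
  have map_ball_pos := (Measure.mem_support_iff_forall _).1 ht _ (Metric.ball_mem_nhds _ hε)
  rw [Measure.map_apply_of_aemeasurable hφ Metric.isOpen_ball.measurableSet] at map_ball_pos
  simpa only [Set.preimage, Metric.mem_ball, dist_eq_norm] using map_ball_pos

lemma ae_mem_closedConvexHull_essRange (φ : Linf) :
    ∀ᵐ t ∂m, φ t ∈ closedConvexHull ℝ (essRange φ) :=
  (ae_mem_essRange φ).mono fun _ ht => subset_closedConvexHull ht

lemma essRange_subset_closedBall (φ : Linf) : essRange φ ⊆ Metric.closedBall 0 ‖φ‖ := by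
  intro w hw
  rw [mem_closedBall_zero_iff]
  refine le_of_forall_pos_le_add fun ε hε => ?_
  obtain ⟨t, norm_sub_lt, norm_le⟩ :=
    ((frequently_ae_iff.2 (hw ε hε).ne').and_eventually (ae_norm_le φ)).exists
  linarith [norm_le_norm_add_norm_sub (φ t) w]

lemma isCompact_closedConvexHull_essRange (φ : Linf) :
    IsCompact (closedConvexHull ℝ (essRange φ)) :=
  (isCompact_closedBall 0 ‖φ‖).of_isClosed_subset isClosed_closedConvexHull
    (closedConvexHull_min (essRange_subset_closedBall φ) (convex_closedBall _ _)
      Metric.isClosed_closedBall)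

lemma ae_mem_ofReal_image_Icc {φ : Linf} (hφ : ∀ᵐ t ∂m, (φ t).im = 0) :
    ∀ᵐ t ∂m, φ t ∈ ((↑) : ℝ → ℂ) ''
      Set.Icc (essInf (fun t => (φ t).re) m) (essSup (fun t => (φ t).re) m) := by
  have abs_re_le : ∀ᵐ t ∂m, |(φ t).re| ≤ ‖φ‖ :=
    (ae_norm_le φ).mono fun t ht => (Complex.abs_re_le_norm _).trans ht
  have essInf_le : ∀ᵐ t ∂m, essInf (fun t => (φ t).re) m ≤ (φ t).re :=
    ae_essInf_le ⟨-‖φ‖, eventually_map.2 (abs_re_le.mono fun t ht => (abs_le.1 ht).1)⟩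
  have le_essSup : ∀ᵐ t ∂m, (φ t).re ≤ essSup (fun t => (φ t).re) m :=
    ae_le_essSup ⟨‖φ‖, eventually_map.2 (abs_re_le.mono fun t ht => (abs_le.1 ht).2)⟩
  filter_upwards [essInf_le, le_essSup, hφ] with t h_inf h_sup h_im
  exact ⟨(φ t).re, ⟨h_inf, h_sup⟩, Complex.ext (Complex.ofReal_re _) h_im.symm⟩

end EssentialRange

section NumericalRange

variable {φ : Linf} {S : Set ℂ}

lemma inner_mulOp_mem (hS : Convex ℝ S) (hSc : IsClosed S) (hφ : ∀ᵐ t ∂m, φ t ∈ S) {u : L2}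
    (hu : ‖u‖ = 1) : inner ℂ u (mulOp φ u) ∈ S := by
  let ρ : Measure 𝕋 := kernelMeasure fun _ : Unit => u
  have hac : ρ ≪ m := withDensity_absolutelyContinuous _ _
  have hρ : IsProbabilityMeasure ρ := ⟨by simp [ρ, kernelMeasure_univ, ← ofReal_norm, hu]⟩
  have inner_eq : inner ℂ u (mulOp φ u) = ∫ t, φ t ∂ρ := by
    simpa using sum_inner_eq_integral_kernelMeasure (fun _ : Unit => u) (coeFn_mulOp φ)
  rw [inner_eq]
  exact hS.integral_mem hSc (hac.ae_le hφ) <|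
    .of_bound ((Lp.aestronglyMeasurable φ).mono_ac hac) ‖φ‖ (hac.ae_le (ae_norm_le φ))

lemma spectrum_compress_mulOp_subset (hS : Convex ℝ S) (hSc : IsClosed S)
    (hφ : ∀ᵐ t ∂m, φ t ∈ S) (K : Submodule ℂ L2) [FiniteDimensional ℂ K] :
    spectrum ℂ (compress K (mulOp φ)) ⊆ S := by
  intro z hz
  obtain ⟨u, hu, rfl⟩ := exists_inner_eq_of_mem_spectrum hz
  rw [inner_compress_right]
  exact inner_mulOp_mem hS hSc hφ hu

lemma isSelfAdjoint_mulOp (hφ : ∀ᵐ t ∂m, (φ t).im = 0) : IsSelfAdjoint (mulOp φ) := by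
  refine ContinuousLinearMap.isSelfAdjoint_iff_isSymmetric.2 fun x y => integral_congr_ae ?_
  filter_upwards [hφ, coeFn_mulOp φ x, coeFn_mulOp φ y] with t h_im h_x h_y
  change inner ℂ (mulOp φ x t) (y t) = inner ℂ (x t) (mulOp φ y t)
  rw [h_x, h_y, RCLike.inner_apply, RCLike.inner_apply, map_mul, Complex.conj_eq_iff_im.2 h_im]
  ring

end NumericalRange

section Limit

lemma tendsto_norm_sub_of_approx {α E : Type*} [SeminormedAddCommGroup E] {l : Filter α}
    {x y : α → E} (h : ∀ ε : ℝ, 0 < ε → ∃ x' y' : α → E,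
      Tendsto (fun a => ‖x' a - y' a‖) l (𝓝 0) ∧
        ∀ᶠ a in l, ‖x a - x' a‖ ≤ ε ∧ ‖y a - y' a‖ ≤ ε) :
    Tendsto (fun a => ‖x a - y a‖) l (𝓝 0) := by
  refine tendsto_order.2 ⟨fun c hc => .of_forall fun a => hc.trans_le (norm_nonneg _),
    fun ε hε => ?_⟩
  obtain ⟨x', y', hlim, happrox⟩ := h (ε / 3) (by positivity)
  filter_upwards [happrox, hlim.eventually_lt_const (by positivity : 0 < ε / 3)]
    with a ⟨hx, hy⟩ hxy
  have split : x a - y a = (x a - x' a) + (x' a - y' a) + (y' a - y a) := by abel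
  rw [norm_sub_rev] at hy
  rw [split]
  linarith [norm_add₃_le (a := x a - x' a) (b := x' a - y' a) (c := y' a - y a)]

lemma integrable_comp_of_continuousOn {α : Type*} [MeasurableSpace α] {μ : Measure α}
    [IsFiniteMeasure μ] {φ : α → ℂ} (hφ : AEMeasurable φ μ) {S : Set ℂ} (hS : IsCompact S)
    (hφS : ∀ᵐ t ∂μ, φ t ∈ S) {F : ℂ → ℂ} (hF : ContinuousOn F S) :
    Integrable (fun t => F (φ t)) μ := by
  classical
  have aestronglyMeasurable : AEStronglyMeasurable (fun t => F (φ t)) μ := by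
    have measurable_piecewise : Measurable (S.piecewise F 0) :=
      hF.measurable_piecewise continuous_zero.continuousOn hS.isClosed.measurableSet
    refine (measurable_piecewise.comp_aemeasurable hφ).aestronglyMeasurable.congr ?_
    filter_upwards [hφS] with t ht using Set.piecewise_eq_of_mem _ _ _ ht
  obtain ⟨C, hC⟩ := hS.exists_bound_of_continuousOn hF
  exact .of_bound aestronglyMeasurable C (hφS.mono fun t ht => hC _ ht)

variable {Λ : ℕ → ℂ} {φ : Linf}

lemma finiteDimensional_modelSpace (hΛ : ∀ j, ‖Λ j‖ < 1) (N : ℕ) :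
    FiniteDimensional ℂ (modelSpace (blaschkeMap hΛ N)) :=
  (modelBasis hΛ N).toBasis.finiteDimensional_of_finite

lemma finrank_modelSpace (hΛ : ∀ j, ‖Λ j‖ < 1) (N : ℕ) :
    Module.finrank ℂ (modelSpace (blaschkeMap hΛ N)) = N := by
  rw [Module.finrank_eq_card_basis (modelBasis hΛ N).toBasis, Fintype.card_fin]

lemma spectrum_toeplitzN_subset (hΛ : ∀ j, ‖Λ j‖ < 1) {S : Set ℂ} (hS : Convex ℝ S)
    (hSc : IsClosed S) (hφ : ∀ᵐ t ∂m, φ t ∈ S) (N : ℕ) : spectrum ℂ (toeplitzN Λ N φ) ⊆ S :=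
  have := finiteDimensional_modelSpace hΛ N
  spectrum_compress_mulOp_subset hS hSc hφ (modelSpace (blaschkeMap hΛ N))

lemma integrable_comp_nu (hΛ : ∀ j, ‖Λ j‖ < 1) {S : Set ℂ} (hS : IsCompact S)
    (hφS : ∀ᵐ t ∂m, φ t ∈ S) {F : ℂ → ℂ} (hF : ContinuousOn F S) (N : ℕ) :
    Integrable (fun t => F (φ t)) (nu Λ N) := by
  have := isFiniteMeasure_nu hΛ N
  have hac := nu_absolutelyContinuous Λ N
  exact integrable_comp_of_continuousOn ((Lp.aestronglyMeasurable φ).mono_ac hac).aemeasurable hS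
    (hac.ae_le hφS) hF

lemma norm_integral_comp_nu_sub_le (hΛ : ∀ j, ‖Λ j‖ < 1) {S : Set ℂ} (hS : IsCompact S)
    (hφS : ∀ᵐ t ∂m, φ t ∈ S) {F G : ℂ → ℂ} (hF : ContinuousOn F S) (hG : ContinuousOn G S) {ε : ℝ}
    (hFG : ∀ z ∈ S, ‖F z - G z‖ ≤ ε) {N : ℕ} (hN : N ≠ 0) :
    ‖∫ t, F (φ t) ∂(nu Λ N) - ∫ t, G (φ t) ∂(nu Λ N)‖ ≤ ε := by
  have := isProbabilityMeasure_nu hΛ hN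
  rw [← integral_sub (integrable_comp_nu hΛ hS hφS hF N) (integrable_comp_nu hΛ hS hφS hG N)]
  have norm_sub_le : ∀ᵐ t ∂(nu Λ N), ‖F (φ t) - G (φ t)‖ ≤ ε :=
    (nu_absolutelyContinuous Λ N).ae_le (hφS.mono fun t ht => hFG _ ht)
  simpa using norm_integral_le_of_norm_le_const norm_sub_le

lemma tendsto_trace_of_polynomial_approx (hΛ : ∀ j, ‖Λ j‖ < 1) (hφ : (φ : 𝕋 → ℂ) ∈ spaceX Λ)
    {S : Set ℂ} (hS : IsCompact S) (hφS : ∀ᵐ t ∂m, φ t ∈ S) {F : ℂ → ℂ} (hF : ContinuousOn F S)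
    (happrox : ∀ ε : ℝ, 0 < ε → ∃ p : Polynomial ℂ, ∀ z ∈ S, ‖F z - p.eval z‖ < ε)
    {τ : ℕ → ℂ} (hτ : ∀ (N : ℕ) (p : Polynomial ℂ) (ε : ℝ), 0 ≤ ε →
      (∀ z ∈ S, ‖F z - p.eval z‖ ≤ ε) →
        ‖τ N - tr (Polynomial.aeval (toeplitzN Λ N φ) p)‖ ≤ N * ε) :
    Tendsto (fun N : ℕ => ‖(1 / (N : ℂ)) * τ N - ∫ t, F (φ t) ∂(nu Λ N)‖) atTop (𝓝 0) := by
  refine tendsto_norm_sub_of_approx fun ε hε => ?_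
  obtain ⟨p, hp⟩ := happrox ε hε
  refine ⟨_, _, tendsto_tr_aeval_toeplitzN hΛ hφ p, ?_⟩
  filter_upwards [eventually_ne_atTop 0] with N hN
  refine ⟨?_, norm_integral_comp_nu_sub_le hΛ hS hφS hF p.continuous.continuousOn
    (fun z hz => (hp z hz).le) hN⟩
  rw [← mul_sub, norm_mul, norm_div, norm_one, Complex.norm_natCast, one_div,
    inv_mul_le_iff₀ (by positivity)]
  exact hτ N p ε hε.le fun z hz => (hp z hz).le

theorem tendsto_tr_holFC_toeplitzN (hΛ : ∀ j, ‖Λ j‖ < 1) (hφ : (φ : 𝕋 → ℂ) ∈ spaceX Λ)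
    {f : ℂ → ℂ} {U : Set ℂ} (hU : IsOpen U) (hKU : closedConvexHull ℝ (essRange φ) ⊆ U)
    (hf : DifferentiableOn ℂ f U) :
    Tendsto (fun N : ℕ => ‖(1 / (N : ℂ)) * tr (holFC f (toeplitzN Λ N φ)) -
      ∫ t, f (φ t) ∂(nu Λ N)‖) atTop (𝓝 0) := by
  have hφK := ae_mem_closedConvexHull_essRange φ
  have hK := isCompact_closedConvexHull_essRange φ
  obtain ⟨t, ht⟩ := hφK.exists
  refine tendsto_trace_of_polynomial_approx hΛ hφ hK hφK (hf.continuousOn.mono hKU)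
    (fun ε hε => exists_polynomial_near_of_differentiableOn hK ht
      (convex_closedConvexHull.starConvex ht) hU hKU hf hε) fun N p ε _ hp => ?_
  have := finiteDimensional_modelSpace hΛ N
  have hspec := spectrum_toeplitzN_subset hΛ convex_closedConvexHull isClosed_closedConvexHull hφK N
  exact (norm_tr_holFC_sub_le (truncToeplitz (blaschkeMap hΛ N) φ) hU hf (hspec.trans hKU) p
    fun z hz => hp z (hspec hz)).trans_eq (by rw [finrank_modelSpace])

lemma continuousOn_comp_re {f : ℝ → ℂ} {s : Set ℝ} (hf : ContinuousOn f s) :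
    ContinuousOn (fun z : ℂ => f z.re) ((↑) '' s) :=
  hf.comp Complex.continuous_re.continuousOn (Set.forall_mem_image.2 fun _ hx => hx)

theorem tendsto_tr_contFC_toeplitzN (hΛ : ∀ j, ‖Λ j‖ < 1) (hφ : (φ : 𝕋 → ℂ) ∈ spaceX Λ)
    (hreal : ∀ᵐ t ∂m, (φ t).im = 0) {f : ℝ → ℂ}
    (hf : ContinuousOn f (Set.Icc (essInf (fun t => (φ t).re) m) (essSup (fun t => (φ t).re) m))) :
    Tendsto (fun N : ℕ => ‖(1 / (N : ℂ)) * tr (contFC f (toeplitzN Λ N φ)) -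
      ∫ t, f (φ t).re ∂(nu Λ N)‖) atTop (𝓝 0) := by
  have hφS := ae_mem_ofReal_image_Icc hreal
  have hF := continuousOn_comp_re hf
  set S : Set ℂ := (↑) '' Set.Icc (essInf (fun t => (φ t).re) m) (essSup (fun t => (φ t).re) m)
  have hS : IsCompact S := isCompact_Icc.image Complex.continuous_ofReal
  have hSconv : Convex ℝ S := (convex_Icc _ _).linear_image Complex.ofRealCLM.toLinearMap
  refine tendsto_trace_of_polynomial_approx hΛ hφ hS hφS hF (fun ε hε => ?_) fun N p ε hε hp => ?_
  · obtain ⟨p, hp⟩ := exists_polynomial_near_of_continuousOn_Icc hf hε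
    exact ⟨p, Set.forall_mem_image.2 hp⟩
  · have hspec := spectrum_toeplitzN_subset hΛ hSconv hS.isClosed hφS N
    have hnormal : IsStarNormal (toeplitzN Λ N φ) :=
      (isSelfAdjoint_compress _ (isSelfAdjoint_mulOp hreal)).isStarNormal
    exact (norm_tr_contFC_sub_le (modelBasis hΛ N) hnormal (hF.mono hspec) p hε
      fun z hz => hp z (hspec hz)).trans_eq (by rw [Fintype.card_fin])

end Limit

end SzegoTTO

end

theorem theorem1 (Λ : ℕ → ℂ) (hΛ : ∀ j, ‖Λ j‖ < 1)
    (φ : SzegoTTO.Linf) (hφ : (φ : SzegoTTO.𝕋 → ℂ) ∈ SzegoTTO.spaceX Λ) :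
    (∀ (f : ℂ → ℂ) (U : Set ℂ), IsOpen U → closedConvexHull ℝ (SzegoTTO.essRange φ) ⊆ U →
      DifferentiableOn ℂ f U →
      (∀ N : ℕ, Integrable (fun t => f (φ t)) (SzegoTTO.nu Λ N)) ∧
      Tendsto (fun N : ℕ =>
        ‖(1 / (N : ℂ)) * SzegoTTO.tr (SzegoTTO.holFC f (SzegoTTO.toeplitzN Λ N φ))
          - ∫ t, f (φ t) ∂(SzegoTTO.nu Λ N)‖) atTop (𝓝 0)) ∧
    ((∀ᵐ t ∂SzegoTTO.m, (φ t).im = 0) →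
      ∀ f : ℝ → ℂ,
        ContinuousOn f (Set.Icc (essInf (fun t => (φ t).re) SzegoTTO.m)
          (essSup (fun t => (φ t).re) SzegoTTO.m)) →
        (∀ N : ℕ, Integrable (fun t => f (φ t).re) (SzegoTTO.nu Λ N)) ∧
        Tendsto (fun N : ℕ =>
          ‖(1 / (N : ℂ)) * SzegoTTO.tr (SzegoTTO.contFC f (SzegoTTO.toeplitzN Λ N φ))
            - ∫ t, f (φ t).re ∂(SzegoTTO.nu Λ N)‖) atTop (𝓝 0)) := by
  refine ⟨fun f U hU hKU hf => ⟨fun N => ?_, ?_⟩, fun hreal f hf => ⟨fun N => ?_, ?_⟩⟩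
  · exact SzegoTTO.integrable_comp_nu hΛ (SzegoTTO.isCompact_closedConvexHull_essRange φ)
      (SzegoTTO.ae_mem_closedConvexHull_essRange φ) (hf.continuousOn.mono hKU) N
  · exact SzegoTTO.tendsto_tr_holFC_toeplitzN hΛ hφ hU hKU hf
  · exact SzegoTTO.integrable_comp_nu hΛ (isCompact_Icc.image Complex.continuous_ofReal)
      (SzegoTTO.ae_mem_ofReal_image_Icc hreal) (SzegoTTO.continuousOn_comp_re hf) N
  · exact SzegoTTO.tendsto_tr_contFC_toeplitzN hΛ hφ hreal hf
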